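/- **Lemma 3.2.** Let $n\ge 1$ and let $\Omega$ be the star graph obtained by gluing $n$ intervals $I_j=[0,l_j]$, $l_j>0$, $j=1,\dots,n$, at the common point $x=0$. Let $b>0$, let $\chi_b:\mathbb R\to\mathbb R$ be a smooth function vanishing outside $(0,2b)$, and let $M\ge 0$. For $h>0$ put $f_h(s)=e^{ih^{-1}s}\chi_b(s)$, and put $T=\min_j l_j$. Then there is a constant $C>0$, depending only on $n$, $l_1,\dots,l_n$, $\chi_b$ and $M$, such that the following holds. Let $q=(q_1,\dots,q_n)$ be a real potential with $q_j\in C^1([0,l_j])$, $|q_j|\le M$ and $|q_j'|\le M$ for all $j$, and let $h>0$. Let $v^h=(v^h_1,\dots,v^h_n)$, with $v^h_j\in C^2([0,l_j]\times[-l_1,T];\mathbb C)$, be a classical solution of $$ \begin{cases} (\partial_t^2-\partial_x^2)v^h_j(x,t)+q_j(x)v^h_j(x,t)=0, & x\in(0,l_j),\ t\in(-l_1,T),\ j=1,\dots,n,\\ v^h_j(x,-l_1)=0,\quad \partial_t v^h_j(x,-l_1)=0, & x\in[0,l_j],\ j=1,\dots,n,\\ v^h_1(l_1,t)=f_h(t+l_1),\quad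 v^h_j(l_j,t)=0 \ \ (j=2,\dots,n), & t\in[-l_1,T],\\ v^h_1(0,t)=\cdots=v^h_n(0,t),\quad \sum_{j=1}^n\partial_x v^h_j(0,t)=0, & t\in[-l_1,T], \end{cases} $$ that is, the geometric optics wave sent at time $-l_1$ from the endpoint $x=l_1$ of $I_1$, with the Kirchhoff–Neumann condition at the center. Then for all $t\in[0,\min_j l_j]$, $$ \Big|\,v^h_1(x,t)-\Big(e^{ih^{-1}(t+x)}\chi_b(t+x)-\frac{n-2}{n}\,e^{ih^{-1}(t-x)}\chi_b(t-x)\Big)\Big|\le C\,h,\qquad x\in I_1, $$ $$ \Big|\,v^h_j(x,t)-\frac{2}{n}\,e^{ih^{-1}(t-x)}\chi_b(t-x)\Big|\le C\,h,\qquad x\in I_j,\quad j=2,\dots,n. $$ -/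

import Mathlib

open Set

noncomputable section

/-- A smooth cutoff near `b`: smooth on `ℝ` and vanishing outside `(0, 2b)`.
(No plateau condition such as `χ = 1` on `[b/2, 3b/2]` is imposed.) -/
structure IsCutoff (b : ℝ) (χ : ℝ → ℝ) : Prop where
  smooth : ContDiff ℝ (⊤ : ℕ∞) χ
  eq_zero : ∀ s, s ∉ Ioo 0 (2 * b) → χ s = 0

/-- The geometric optics profile `s ↦ exp (i s / h) χ(s)`. -/
def goProfile (h : ℝ) (χ : ℝ → ℝ) (s : ℝ) : ℂ :=
  Complex.exp (Complex.I * (s : ℂ) / (h : ℂ)) * (χ s : ℂ)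

/-- A potential on the star graph with edges `[0, l j]`, continuously differentiable on each
closed edge, with `C¹` norm (maximum of the sup norms of `q` and `q'`) at most `M`. -/
structure IsC1PotentialWithBound {n : ℕ} (l : Fin n → ℝ) (M : ℝ) (q : Fin n → ℝ → ℝ) :
    Prop where
  contDiffOn : ∀ j, ContDiffOn ℝ 1 (q j) (Icc 0 (l j))
  abs_le : ∀ j, ∀ x ∈ Icc 0 (l j), |q j x| ≤ M
  abs_deriv_le : ∀ j, ∀ x ∈ Icc 0 (l j), |derivWithin (q j) (Icc 0 (l j)) x| ≤ M

/-- `v` is a classical solution, on the time interval `[t₀, T]`, of the wave equation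
`(∂ₜ² - ∂ₓ²) v + q v = 0` on the star graph obtained by gluing the intervals `[0, l j]`
at `x = 0`. The solution has zero Cauchy data at time `t₀`, satisfies the Kirchhoff-Neumann
condition at the center `x = 0`, and the Dirichlet condition `v = f j` at the leaf `x = l j`.
Here `v j x t` is the value of `v` at the point `x` of the `j`-th edge at time `t`. -/
structure IsClassicalStarSolution {n : ℕ} (l : Fin n → ℝ) (q : Fin n → ℝ → ℝ)
    (f : Fin n → ℝ → ℂ) (t₀ T : ℝ) (v : Fin n → ℝ → ℝ → ℂ) : Prop where
  /-- `v` is twice continuously differentiable, up to the boundary, on each edge. -/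
  contDiffOn : ∀ j,
    ContDiffOn ℝ 2 (fun p : ℝ × ℝ => v j p.1 p.2) (Icc 0 (l j) ×ˢ Icc t₀ T)
  /-- The wave equation in the interior of each edge. -/
  wave : ∀ j, ∀ x ∈ Ioo 0 (l j), ∀ t ∈ Ioo t₀ T,
    iteratedDeriv 2 (fun s => v j x s) t - iteratedDeriv 2 (fun y => v j y t) x
      + (q j x : ℂ) * v j x t = 0
  /-- Zero initial position. -/
  initial : ∀ j, ∀ x ∈ Icc 0 (l j), v j x t₀ = 0
  /-- Zero initial velocity. -/
  initial_deriv : ∀ j, ∀ x ∈ Icc 0 (l j), derivWithin (fun s => v j x s) (Icc t₀ T) t₀ = 0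
  /-- Dirichlet data at the leaves. -/
  dirichlet : ∀ j, ∀ t ∈ Icc t₀ T, v j (l j) t = f j t
  /-- Continuity at the center. -/
  continuity : ∀ j k, ∀ t ∈ Icc t₀ T, v j 0 t = v k 0 t
  /-- The outward derivatives at the center sum to zero. -/
  kirchhoff : ∀ t ∈ Icc t₀ T, ∑ j, derivWithin (fun x => v j x t) (Icc 0 (l j)) 0 = 0

/-- The boundary source: the geometric optics profile is sent at time `-l 0` from the leaf of the
edge with index `0`, and the data at all other leaves is zero. -/
def starSource {n : ℕ} [NeZero n] (l : Fin n → ℝ) (h : ℝ) (χ : ℝ → ℝ) (j : Fin n) (t : ℝ) : ℂ :=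
  if j = 0 then goProfile h χ (t + l 0) else 0

end

/-!
The leading-order waves `f (t + x)` and `β f (t - x)`, with `f (s) = exp (i s / h) χ(s)`, satisfy
the free wave equation and all boundary conditions, but leave the source `q f`, which is only
`O(1)`. Its oscillation has to be used. With `F` the primitive of `f`, which is `O(h)` by
integration by parts (`exists_norm_primitive_goProfile_le`), a corrector `A(x) F(t + x)` with
`2 A' = q` cancels the source up to terms `A'' F` and `q A F` of size `O(h)`; this is where the
derivative of `q` enters. The outgoing waves get correctors `B(x) F(t - x)` in the same way. The
amplitudes `A` and `B` can be matched at the center up to a flux that is a constant times `F(t)`,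
and this is removed by a further wave `c G(t - x)`, with `G` the primitive of `F`. Until the time
`min l j` the outgoing waves have not reached the leaves, so the resulting ansatz satisfies the
initial and boundary conditions exactly, and it is within `O(h)` of the leading-order waves
(`exists_isStarAmplitudes`, `IsStarAmplitudes.norm_ansatz_residual_le`,
`IsStarAmplitudes.norm_ansatz_sub_le`).

The difference between a classical solution and the ansatz then has homogeneous data and a source
of size `O(h)`. The divergence theorem, applied on each edge to the energy density
`‖∂ₜw‖² + ‖∂ₓw‖² + ‖w‖²` with a weight decaying exponentially in time, bounds the total energy by
the square of the source; the exponential weight absorbs the potential, so that Gronwall's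
inequality is not needed. Every edge ends in a leaf where `w` vanishes, so the energy bounds `w`
uniformly (`norm_sq_le_of_star_wave_eq`).
-/

/-! ### Partial derivatives on a closed rectangle -/

section Rectangle

open MeasureTheory Topology

variable {E : Type*} [NormedAddCommGroup E] [InnerProductSpace ℝ E]

/-- The partial derivative in the first variable, within `s`, as a component of the Fréchet
derivative. On a closed rectangle it is defined and continuous up to the boundary. -/
noncomputable def partialFst (s : Set (ℝ × ℝ)) (U : ℝ × ℝ → E) (p : ℝ × ℝ) : E :=
  fderivWithin ℝ U s p (1, 0)

/-- The partial derivative in the second variable, within `s`; see `partialFst`. -/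
noncomputable def partialSnd (s : Set (ℝ × ℝ)) (U : ℝ × ℝ → E) (p : ℝ × ℝ) : E :=
  fderivWithin ℝ U s p (0, 1)

lemma hasDerivAt_prodMk_left (x t : ℝ) :
    HasDerivAt (fun y : ℝ => (y, t)) ((1, 0) : ℝ × ℝ) x :=
  (hasDerivAt_id x).prodMk (hasDerivAt_const x t)

lemma hasDerivAt_prodMk_right (x t : ℝ) :
    HasDerivAt (fun s : ℝ => (x, s)) ((0, 1) : ℝ × ℝ) t :=
  (hasDerivAt_const t x).prodMk (hasDerivAt_id t)

variable {a t₀ T : ℝ} {U : ℝ × ℝ → E}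

lemma uniqueDiffOn_rectangle (ha : 0 < a) (hT : t₀ < T) :
    UniqueDiffOn ℝ (Icc 0 a ×ˢ Icc t₀ T) :=
  (uniqueDiffOn_Icc ha).prod (uniqueDiffOn_Icc hT)

lemma rectangle_mem_nhds {x t : ℝ} (hx : x ∈ Ioo 0 a) (ht : t ∈ Ioo t₀ T) :
    Icc 0 a ×ˢ Icc t₀ T ∈ 𝓝 (x, t) :=
  prod_mem_nhds (Icc_mem_nhds hx.1 hx.2) (Icc_mem_nhds ht.1 ht.2)

lemma contDiffOn_partialFst (ha : 0 < a) (hT : t₀ < T)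
    (hU : ContDiffOn ℝ 2 U (Icc 0 a ×ˢ Icc t₀ T)) :
    ContDiffOn ℝ 1 (partialFst (Icc 0 a ×ˢ Icc t₀ T) U) (Icc 0 a ×ˢ Icc t₀ T) :=
  (hU.fderivWithin (uniqueDiffOn_rectangle ha hT) (by norm_num)).clm_apply contDiffOn_const

lemma contDiffOn_partialSnd (ha : 0 < a) (hT : t₀ < T)
    (hU : ContDiffOn ℝ 2 U (Icc 0 a ×ˢ Icc t₀ T)) :
    ContDiffOn ℝ 1 (partialSnd (Icc 0 a ×ˢ Icc t₀ T) U) (Icc 0 a ×ˢ Icc t₀ T) :=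
  (hU.fderivWithin (uniqueDiffOn_rectangle ha hT) (by norm_num)).clm_apply contDiffOn_const

lemma hasDerivWithinAt_partialFst
    (hU : DifferentiableOn ℝ U (Icc 0 a ×ˢ Icc t₀ T)) {x t : ℝ} (hx : x ∈ Icc 0 a)
    (ht : t ∈ Icc t₀ T) :
    HasDerivWithinAt (fun y => U (y, t)) (partialFst (Icc 0 a ×ˢ Icc t₀ T) U (x, t))
      (Icc 0 a) x :=
  (hU (x, t) ⟨hx, ht⟩).hasFDerivWithinAt.comp_hasDerivWithinAt
    (t := Icc 0 a ×ˢ Icc t₀ T) x (hasDerivAt_prodMk_left x t).hasDerivWithinAt fun _ hy => ⟨hy, ht⟩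

lemma hasDerivWithinAt_partialSnd
    (hU : DifferentiableOn ℝ U (Icc 0 a ×ˢ Icc t₀ T)) {x t : ℝ} (hx : x ∈ Icc 0 a)
    (ht : t ∈ Icc t₀ T) :
    HasDerivWithinAt (fun s => U (x, s)) (partialSnd (Icc 0 a ×ˢ Icc t₀ T) U (x, t))
      (Icc t₀ T) t :=
  (hU (x, t) ⟨hx, ht⟩).hasFDerivWithinAt.comp_hasDerivWithinAt
    (t := Icc 0 a ×ˢ Icc t₀ T) t (hasDerivAt_prodMk_right x t).hasDerivWithinAt fun _ hy => ⟨hx, hy⟩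

/-- The derivatives of the first-order partial derivatives at an interior point. The mixed
derivatives agree, so that a single vector `m` serves for both. -/
lemma exists_hasDerivAt_partials (ha : 0 < a) (hT : t₀ < T)
    (hU : ContDiffOn ℝ 2 U (Icc 0 a ×ˢ Icc t₀ T)) {x t : ℝ} (hx : x ∈ Ioo 0 a)
    (ht : t ∈ Ioo t₀ T) :
    ∃ m : E,
      HasDerivAt (fun y => partialFst (Icc 0 a ×ˢ Icc t₀ T) U (y, t))
        (iteratedDeriv 2 (fun y => U (y, t)) x) x ∧
      HasDerivAt (fun s => partialSnd (Icc 0 a ×ˢ Icc t₀ T) U (x, s))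
        (iteratedDeriv 2 (fun s => U (x, s)) t) t ∧
      HasDerivAt (fun y => partialSnd (Icc 0 a ×ˢ Icc t₀ T) U (y, t)) m x ∧
      HasDerivAt (fun s => partialFst (Icc 0 a ×ˢ Icc t₀ T) U (x, s)) m t := by
  have hd := hU.differentiableOn (by norm_num)
  have hR : Icc 0 a ×ˢ Icc t₀ T ∈ 𝓝 (x, t) := rectangle_mem_nhds hx ht
  set R : Set (ℝ × ℝ) := Icc 0 a ×ˢ Icc t₀ T
  have hcd : ContDiffAt ℝ 2 U (x, t) := hU.contDiffAt hR
  have hDR : ContDiffAt ℝ 1 (fderivWithin ℝ U R) (x, t) :=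
    (hU.fderivWithin (uniqueDiffOn_rectangle ha hT) (by norm_num)).contDiffAt hR
  have hB := (hDR.differentiableAt one_ne_zero).hasFDerivAt
  have heq : fderivWithin ℝ U R =ᶠ[𝓝 (x, t)] fderiv ℝ U := by
    filter_upwards [eventually_mem_nhds_iff.2 hR] with p hp using fderivWithin_of_mem_nhds hp
  have hsym := hcd.isSymmSndFDerivAt (by simp)
  rw [IsSymmSndFDerivAt, ← heq.fderiv_eq] at hsym
  set B := fderiv ℝ (fderivWithin ℝ U R) (x, t)
  have hfst (e : ℝ × ℝ) : HasDerivAt (fun y => fderivWithin ℝ U R (y, t) e) (B (1, 0) e) x :=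
    (ContinuousLinearMap.apply ℝ E e).hasFDerivAt.comp_hasDerivAt x
      (hB.comp_hasDerivAt (f := fun y => (y, t)) x (hasDerivAt_prodMk_left x t))
  have hsnd (e : ℝ × ℝ) : HasDerivAt (fun s => fderivWithin ℝ U R (x, s) e) (B (0, 1) e) t :=
    (ContinuousLinearMap.apply ℝ E e).hasFDerivAt.comp_hasDerivAt t
      (hB.comp_hasDerivAt (f := fun s => (x, s)) t (hasDerivAt_prodMk_right x t))
  have hxx : iteratedDeriv 2 (fun y => U (y, t)) x = B (1, 0) (1, 0) := by
    rw [iteratedDeriv_succ, iteratedDeriv_one, ← (hfst (1, 0)).deriv]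
    refine Filter.EventuallyEq.deriv_eq ?_
    filter_upwards [Ioo_mem_nhds hx.1 hx.2] with y hy
    exact ((hasDerivWithinAt_partialFst hd (Ioo_subset_Icc_self hy)
      (Ioo_subset_Icc_self ht)).hasDerivAt (Icc_mem_nhds hy.1 hy.2)).deriv
  have htt : iteratedDeriv 2 (fun s => U (x, s)) t = B (0, 1) (0, 1) := by
    rw [iteratedDeriv_succ, iteratedDeriv_one, ← (hsnd (0, 1)).deriv]
    refine Filter.EventuallyEq.deriv_eq ?_
    filter_upwards [Ioo_mem_nhds ht.1 ht.2] with y hy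
    exact ((hasDerivWithinAt_partialSnd hd (Ioo_subset_Icc_self hx)
      (Ioo_subset_Icc_self hy)).hasDerivAt (Icc_mem_nhds hy.1 hy.2)).deriv
  refine ⟨B (1, 0) (0, 1), ?_, ?_, hfst _, ?_⟩
  · rw [hxx]; exact hfst _
  · rw [htt]; exact hsnd _
  · rw [hsym]; exact hsnd _

/-! ### The energy estimate -/

/-- The energy density `‖∂ₜU‖² + ‖∂ₓU‖² + ‖U‖²`. -/
noncomputable def energyDensity (s : Set (ℝ × ℝ)) (U : ℝ × ℝ → E) (p : ℝ × ℝ) : ℝ :=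
  ‖partialSnd s U p‖ ^ 2 + ‖partialFst s U p‖ ^ 2 + ‖U p‖ ^ 2

/-- The energy flux `-2 ⟪∂ₓU, ∂ₜU⟫` through a point, in the direction of increasing `x`. -/
noncomputable def energyFlux (s : Set (ℝ × ℝ)) (U : ℝ × ℝ → E) (p : ℝ × ℝ) : ℝ :=
  -2 * inner ℝ (partialFst s U p) (partialSnd s U p)

lemma contDiffOn_energyDensity (ha : 0 < a) (hT : t₀ < T)
    (hU : ContDiffOn ℝ 2 U (Icc 0 a ×ˢ Icc t₀ T)) :
    ContDiffOn ℝ 1 (energyDensity (Icc 0 a ×ˢ Icc t₀ T) U) (Icc 0 a ×ˢ Icc t₀ T) :=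
  (((contDiffOn_partialSnd ha hT hU).norm_sq ℝ).add
    ((contDiffOn_partialFst ha hT hU).norm_sq ℝ)).add ((hU.of_le (by norm_num)).norm_sq ℝ)

lemma contDiffOn_energyFlux (ha : 0 < a) (hT : t₀ < T)
    (hU : ContDiffOn ℝ 2 U (Icc 0 a ×ˢ Icc t₀ T)) :
    ContDiffOn ℝ 1 (energyFlux (Icc 0 a ×ˢ Icc t₀ T) U) (Icc 0 a ×ˢ Icc t₀ T) :=
  contDiffOn_const.mul
    ((contDiffOn_partialFst ha hT hU).inner ℝ (contDiffOn_partialSnd ha hT hU))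

/-- The differential energy inequality: with the weight `exp (-(2 + M) (t - t₀))` the divergence
of (flux, density) is controlled by the source alone. -/
lemma weighted_energy_divergence_le {M ε q : ℝ} (ha : 0 < a) (hT : t₀ < T)
    (hU : ContDiffOn ℝ 2 U (Icc 0 a ×ˢ Icc t₀ T)) {x t : ℝ} (hx : x ∈ Ioo 0 a)
    (ht : t ∈ Ioo t₀ T) (hq : |q| ≤ M)
    (hwave : ‖iteratedDeriv 2 (fun s => U (x, s)) t - iteratedDeriv 2 (fun y => U (y, t)) x
      + q • U (x, t)‖ ≤ ε) :
    ∃ d₁ d₂ : ℝ,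
      HasDerivAt (fun y => Real.exp (-(2 + M) * (t - t₀)) *
        energyFlux (Icc 0 a ×ˢ Icc t₀ T) U (y, t)) d₁ x ∧
      HasDerivAt (fun s => Real.exp (-(2 + M) * (s - t₀)) *
        energyDensity (Icc 0 a ×ˢ Icc t₀ T) U (x, s)) d₂ t ∧
      d₁ + d₂ ≤ ε ^ 2 := by
  obtain ⟨m, hxx, htt, hm₁, hm₂⟩ := exists_hasDerivAt_partials ha hT hU hx ht
  have hUt := (hasDerivWithinAt_partialSnd (hU.differentiableOn (by norm_num))
    (Ioo_subset_Icc_self hx) (Ioo_subset_Icc_self ht)).hasDerivAt (Icc_mem_nhds ht.1 ht.2)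
  have hφ : HasDerivAt (fun s => Real.exp (-(2 + M) * (s - t₀)))
      (Real.exp (-(2 + M) * (t - t₀)) * -(2 + M)) t :=
    ((((hasDerivAt_id t).sub_const t₀).const_mul (-(2 + M))).exp).congr_deriv (by simp)
  have h₁ := ((hxx.inner ℝ hm₁).const_mul (-2)).const_mul (Real.exp (-(2 + M) * (t - t₀)))
  have h₂ := hφ.mul ((htt.norm_sq.add hm₂.norm_sq).add hUt.norm_sq)
  refine ⟨_, _, h₁, h₂, ?_⟩
  simp only [Pi.add_apply]
  set uxx := iteratedDeriv 2 (fun y => U (y, t)) x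
  set utt := iteratedDeriv 2 (fun s => U (x, s)) t
  set ut := partialSnd (Icc 0 a ×ˢ Icc t₀ T) U (x, t)
  set ux := partialFst (Icc 0 a ×ˢ Icc t₀ T) U (x, t)
  set u := U (x, t)
  set φ := Real.exp (-(2 + M) * (t - t₀))
  have hM : 0 ≤ M := (abs_nonneg q).trans hq
  have hφ0 : 0 ≤ φ := (Real.exp_pos _).le
  have hφ1 : φ ≤ 1 := Real.exp_le_one_iff.2 (by nlinarith [ht.1])
  have hW : ‖utt - uxx‖ ≤ ε + M * ‖u‖ := by
    calc ‖utt - uxx‖ = ‖(utt - uxx + q • u) - q • u‖ := by rw [add_sub_cancel_right]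
      _ ≤ ‖utt - uxx + q • u‖ + ‖q • u‖ := norm_sub_le _ _
      _ ≤ ε + M * ‖u‖ := by
        rw [norm_smul, Real.norm_eq_abs]
        gcongr
  have hb₁ : inner ℝ ut (utt - uxx) ≤ ‖ut‖ * (ε + M * ‖u‖) :=
    (real_inner_le_norm _ _).trans (by gcongr)
  have hb₂ : inner ℝ u ut ≤ ‖u‖ * ‖ut‖ := real_inner_le_norm _ _
  rw [inner_sub_right] at hb₁
  have hcore : -(2 + M) * (‖ut‖ ^ 2 + ‖ux‖ ^ 2 + ‖u‖ ^ 2) + 2 * inner ℝ ut utt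
      - 2 * inner ℝ ut uxx + 2 * inner ℝ u ut ≤ ε ^ 2 := by
    nlinarith [sq_nonneg (‖ut‖ - ε), sq_nonneg (‖ut‖ - ‖u‖),
      mul_nonneg hM (sq_nonneg (‖ut‖ - ‖u‖)), mul_nonneg hM (sq_nonneg ‖ux‖), sq_nonneg ‖ux‖]
  rw [real_inner_comm ut uxx]
  calc _ = φ * (-(2 + M) * (‖ut‖ ^ 2 + ‖ux‖ ^ 2 + ‖u‖ ^ 2) + 2 * inner ℝ ut utt
      - 2 * inner ℝ ut uxx + 2 * inner ℝ u ut) := by ring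
    _ ≤ φ * ε ^ 2 := by gcongr
    _ ≤ ε ^ 2 := mul_le_of_le_one_left (sq_nonneg _) hφ1

/-- The energy balance on one edge up to time `τ`: the divergence theorem applied to the weighted
energy density and flux. -/
lemma weighted_energy_le {M ε : ℝ} {q : ℝ → ℝ} (ha : 0 < a) (hT : t₀ < T)
    (hU : ContDiffOn ℝ 2 U (Icc 0 a ×ˢ Icc t₀ T)) (hq : ∀ x ∈ Icc 0 a, |q x| ≤ M)
    (hwave : ∀ x ∈ Ioo 0 a, ∀ t ∈ Ioo t₀ T,
      ‖iteratedDeriv 2 (fun s => U (x, s)) t - iteratedDeriv 2 (fun y => U (y, t)) x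
        + q x • U (x, t)‖ ≤ ε) {τ : ℝ} (hτ : τ ∈ Ioc t₀ T) :
    (∫ x in (0)..a, Real.exp (-(2 + M) * (τ - t₀)) *
        energyDensity (Icc 0 a ×ˢ Icc t₀ T) U (x, τ)) -
      (∫ x in (0)..a, energyDensity (Icc 0 a ×ˢ Icc t₀ T) U (x, t₀)) +
      (∫ t in t₀..τ, Real.exp (-(2 + M) * (t - t₀)) *
        energyFlux (Icc 0 a ×ˢ Icc t₀ T) U (a, t)) -
      (∫ t in t₀..τ, Real.exp (-(2 + M) * (t - t₀)) *
        energyFlux (Icc 0 a ×ˢ Icc t₀ T) U (0, t)) ≤ ε ^ 2 * (a * (τ - t₀)) := by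
  set R : Set (ℝ × ℝ) := Icc 0 a ×ˢ Icc t₀ T
  have hweight : ContDiffOn ℝ 1 (fun p : ℝ × ℝ => Real.exp (-(2 + M) * (p.2 - t₀))) R := by
    fun_prop
  set f : ℝ × ℝ → ℝ := fun p => Real.exp (-(2 + M) * (p.2 - t₀)) * energyFlux R U p with hf
  set g : ℝ × ℝ → ℝ := fun p => Real.exp (-(2 + M) * (p.2 - t₀)) * energyDensity R U p with hg
  have hfc : ContDiffOn ℝ 1 f R := hweight.mul (contDiffOn_energyFlux ha hT hU)
  have hgc : ContDiffOn ℝ 1 g R := hweight.mul (contDiffOn_energyDensity ha hT hU)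
  have hR := uniqueDiffOn_rectangle ha hT
  have hS : Icc ((0, t₀) : ℝ × ℝ) (a, τ) ⊆ R := by
    rw [Icc_prod_eq]
    exact prod_mono_right (Icc_subset_Icc_right hτ.2)
  have hle : ((0, t₀) : ℝ × ℝ) ≤ (a, τ) := ⟨ha.le, hτ.1.le⟩
  have hdiff (k : ℝ × ℝ → ℝ) (hk : ContDiffOn ℝ 1 k R) (p : ℝ × ℝ)
      (hp : p ∈ Ioo 0 a ×ˢ Ioo t₀ τ) : HasFDerivAt k (fderivWithin ℝ k R p) p :=
    ((hk.differentiableOn one_ne_zero) p ⟨Ioo_subset_Icc_self hp.1, hp.2.1.le,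
      hp.2.2.le.trans hτ.2⟩).hasFDerivWithinAt.hasFDerivAt
      (rectangle_mem_nhds hp.1 ⟨hp.2.1, hp.2.2.trans_le hτ.2⟩)
  have hcont : ContinuousOn
      (fun p => fderivWithin ℝ f R p (1, 0) + fderivWithin ℝ g R p (0, 1)) R :=
    ((hfc.continuousOn_fderivWithin hR le_rfl).clm_apply continuousOn_const).add
      ((hgc.continuousOn_fderivWithin hR le_rfl).clm_apply continuousOn_const)
  have hint : IntegrableOn
      (fun p => fderivWithin ℝ f R p (1, 0) + fderivWithin ℝ g R p (0, 1))
      (Icc ((0, t₀) : ℝ × ℝ) (a, τ)) :=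
    (hcont.mono hS).integrableOn_compact isCompact_Icc
  have key := integral_divergence_prod_Icc_of_hasFDerivAt_of_le f g
    (fderivWithin ℝ f R) (fderivWithin ℝ g R) (0, t₀) (a, τ) hle
    (hfc.continuousOn.mono hS) (hgc.continuousOn.mono hS)
    (hdiff f hfc) (hdiff g hgc) hint
  have hbound : ∀ p ∈ Icc ((0, t₀) : ℝ × ℝ) (a, τ),
      fderivWithin ℝ f R p (1, 0) + fderivWithin ℝ g R p (0, 1) ≤ ε ^ 2 := by
    intro p hp
    -- inside the rectangle this is the differential inequality; the boundary follows by continuity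
    refine ContinuousWithinAt.closure_le (s := Ioo 0 a ×ˢ Ioo t₀ τ) ?_
      ((hcont p (hS hp)).mono ?_) continuousWithinAt_const ?_
    · rw [closure_prod_eq, closure_Ioo ha.ne, closure_Ioo hτ.1.ne]
      rwa [Icc_prod_eq] at hp
    · exact prod_mono Ioo_subset_Icc_self
        (Ioo_subset_Icc_self.trans (Icc_subset_Icc_right hτ.2))
    · rintro ⟨x, t⟩ hxt
      have ht : t ∈ Ioo t₀ T := ⟨hxt.2.1, hxt.2.2.trans_le hτ.2⟩
      obtain ⟨d₁, d₂, h₁, h₂, hd⟩ := weighted_energy_divergence_le ha hT hU hxt.1 ht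
        (hq x (Ioo_subset_Icc_self hxt.1)) (hwave x hxt.1 t ht)
      have e₁ : fderivWithin ℝ f R (x, t) (1, 0) = d₁ :=
        ((hdiff f hfc (x, t) hxt).comp_hasDerivAt (f := fun y => (y, t)) x
          (hasDerivAt_prodMk_left x t)).unique h₁
      have e₂ : fderivWithin ℝ g R (x, t) (0, 1) = d₂ :=
        ((hdiff g hgc (x, t) hxt).comp_hasDerivAt (f := fun s => (x, s)) t
          (hasDerivAt_prodMk_right x t)).unique h₂
      rw [e₁, e₂]
      exact hd
  have hle' := setIntegral_mono_on hint
    (integrableOn_const isCompact_Icc.measure_ne_top) measurableSet_Icc hbound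
  have hvol : (volume : Measure (ℝ × ℝ)).real (Icc ((0, t₀) : ℝ × ℝ) (a, τ)) = a * (τ - t₀) := by
    rw [Icc_prod_eq, Measure.volume_eq_prod, measureReal_prod_prod]
    simp [ha.le, hτ.1.le]
  rw [key, setIntegral_const, hvol, smul_eq_mul, mul_comm (a * (τ - t₀))] at hle'
  simp only [hf, hg, sub_self, mul_zero, Real.exp_zero, one_mul] at hle'
  exact hle'

/-- The one-dimensional Sobolev inequality for a function that vanishes at the right end. -/
lemma norm_sq_le_mul_integral_norm_deriv_sq [CompleteSpace E] {φ φ' : ℝ → E} (ha : 0 < a)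
    (hφ : ∀ x ∈ Icc 0 a, HasDerivWithinAt φ (φ' x) (Icc 0 a) x)
    (hφ' : ContinuousOn φ' (Icc 0 a)) (h0 : φ a = 0) {x : ℝ} (hx : x ∈ Icc 0 a) :
    ‖φ x‖ ^ 2 ≤ a * ∫ y in (0)..a, ‖φ' y‖ ^ 2 := by
  have hsub : Icc x a ⊆ Icc 0 a := Icc_subset_Icc_left hx.1
  have hc : ContinuousOn φ' (uIcc x a) := by rw [uIcc_of_le hx.2]; exact hφ'.mono hsub
  have hftc : ∫ y in x..a, φ' y = φ a - φ x := by
    refine intervalIntegral.integral_eq_sub_of_hasDerivAt_of_le hx.2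
      (fun y hy => ((hφ y (hsub hy)).continuousWithinAt).mono hsub) (fun y hy => ?_)
      hc.intervalIntegrable
    have hy' : y ∈ Ioo 0 a := ⟨hx.1.trans_lt hy.1, hy.2⟩
    exact (hφ y (Ioo_subset_Icc_self hy')).hasDerivAt (Icc_mem_nhds hy'.1 hy'.2)
  have hn : ContinuousOn (fun y => ‖φ' y‖) (uIcc x a) := hc.norm
  set m : ℝ := ∫ y in x..a, ‖φ' y‖
  set I : ℝ := ∫ y in x..a, ‖φ' y‖ ^ 2
  have hxm : ‖φ x‖ ≤ m := by
    have := intervalIntegral.norm_integral_le_integral_norm (f := φ') (μ := volume) hx.2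
    rwa [hftc, h0, zero_sub, norm_neg] at this
  -- Cauchy–Schwarz, from the nonnegative integral of `(a ‖φ'‖ - m) ^ 2`
  have hcs : 0 ≤ a ^ 2 * I - 2 * a * m * m + m ^ 2 * (a - x) := by
    have h := intervalIntegral.integral_nonneg (μ := volume) hx.2
      (fun y _ => sq_nonneg (a * ‖φ' y‖ - m))
    have he : (fun y => (a * ‖φ' y‖ - m) ^ 2)
        = fun y => a ^ 2 * ‖φ' y‖ ^ 2 - 2 * a * m * ‖φ' y‖ + m ^ 2 := by ext y; ring
    rw [he, intervalIntegral.integral_add, intervalIntegral.integral_sub,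
      intervalIntegral.integral_const_mul, intervalIntegral.integral_const_mul,
      intervalIntegral.integral_const, smul_eq_mul, mul_comm (a - x)] at h
    · exact h
    · exact ((hn.pow 2).intervalIntegrable).const_mul _
    · exact hn.intervalIntegrable.const_mul _
    · exact (((hn.pow 2).intervalIntegrable).const_mul _).sub (hn.intervalIntegrable.const_mul _)
    · exact intervalIntegrable_const
  have hI : I ≤ ∫ y in (0)..a, ‖φ' y‖ ^ 2 := by
    refine intervalIntegral.integral_mono_interval hx.1 hx.2 le_rfl
      (Filter.Eventually.of_forall fun y => sq_nonneg _) ?_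
    refine ContinuousOn.intervalIntegrable ?_
    rw [uIcc_of_le ha.le]
    exact hφ'.norm.pow 2
  have hmI : m ^ 2 ≤ a * I := by
    have : 0 ≤ a * (a * I - m ^ 2) := by nlinarith [mul_nonneg hx.1 (sq_nonneg m)]
    linarith [nonneg_of_mul_nonneg_right this ha]
  calc ‖φ x‖ ^ 2 ≤ m ^ 2 := by gcongr
    _ ≤ a * I := hmI
    _ ≤ _ := by gcongr

end Rectangle

/-! ### Uniform estimates on the star graph -/

section StarEnergy

open MeasureTheory

variable {E : Type*} [NormedAddCommGroup E] [InnerProductSpace ℝ E]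

lemma derivWithin_eq_partialFst {a t₀ T : ℝ} {U : ℝ × ℝ → E} (ha : 0 < a)
    (hU : DifferentiableOn ℝ U (Icc 0 a ×ˢ Icc t₀ T)) {x t : ℝ} (hx : x ∈ Icc 0 a)
    (ht : t ∈ Icc t₀ T) :
    derivWithin (fun y => U (y, t)) (Icc 0 a) x = partialFst (Icc 0 a ×ˢ Icc t₀ T) U (x, t) :=
  (hasDerivWithinAt_partialFst hU hx ht).derivWithin (uniqueDiffOn_Icc ha x hx)

lemma derivWithin_eq_partialSnd {a t₀ T : ℝ} {U : ℝ × ℝ → E} (hT : t₀ < T)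
    (hU : DifferentiableOn ℝ U (Icc 0 a ×ˢ Icc t₀ T)) {x t : ℝ} (hx : x ∈ Icc 0 a)
    (ht : t ∈ Icc t₀ T) :
    derivWithin (fun s => U (x, s)) (Icc t₀ T) t = partialSnd (Icc 0 a ×ˢ Icc t₀ T) U (x, t) :=
  (hasDerivWithinAt_partialSnd hU hx ht).derivWithin (uniqueDiffOn_Icc hT t ht)

/-- Uniform estimate for the inhomogeneous wave equation on a star graph with homogeneous initial,
Dirichlet and Kirchhoff–Neumann data: the fluxes through the leaves vanish, and those through the
center add up to zero, so that the total energy is controlled by the source. -/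
theorem norm_sq_le_of_star_wave_eq [CompleteSpace E] {n : ℕ} {l : Fin n → ℝ}
    (hl : ∀ j, 0 < l j) {t₀ T : ℝ} (hT : t₀ < T) {M ε : ℝ} {q : Fin n → ℝ → ℝ}
    (hq : ∀ j, ∀ x ∈ Icc 0 (l j), |q j x| ≤ M) {w : Fin n → ℝ × ℝ → E}
    (hw : ∀ j, ContDiffOn ℝ 2 (w j) (Icc 0 (l j) ×ˢ Icc t₀ T))
    (hwave : ∀ j, ∀ x ∈ Ioo 0 (l j), ∀ t ∈ Ioo t₀ T,
      ‖iteratedDeriv 2 (fun s => w j (x, s)) t - iteratedDeriv 2 (fun y => w j (y, t)) x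
        + q j x • w j (x, t)‖ ≤ ε)
    (hinit : ∀ j, ∀ x ∈ Icc 0 (l j), w j (x, t₀) = 0)
    (hinit' : ∀ j, ∀ x ∈ Icc 0 (l j), derivWithin (fun s => w j (x, s)) (Icc t₀ T) t₀ = 0)
    (hdir : ∀ j, ∀ t ∈ Icc t₀ T, w j (l j, t) = 0)
    (hcont : ∀ j k, ∀ t ∈ Icc t₀ T, w j (0, t) = w k (0, t))
    (hkir : ∀ t ∈ Icc t₀ T, ∑ j, derivWithin (fun x => w j (x, t)) (Icc 0 (l j)) 0 = 0)
    (k : Fin n) {x τ : ℝ} (hx : x ∈ Icc 0 (l k)) (hτ : τ ∈ Icc t₀ T) :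
    ‖w k (x, τ)‖ ^ 2
      ≤ l k * (Real.exp ((2 + M) * (T - t₀)) * (ε ^ 2 * ((∑ j, l j) * (T - t₀)))) := by
  have hsum0 : 0 ≤ ∑ j, l j := Finset.sum_nonneg fun j _ => (hl j).le
  rcases hτ.1.eq_or_lt with rfl | hτ0
  · rw [hinit k x hx, norm_zero, zero_pow two_ne_zero]
    have := (hl k).le
    have := sub_nonneg.2 hT.le
    positivity
  have hd j : DifferentiableOn ℝ (w j) (Icc 0 (l j) ×ˢ Icc t₀ T) :=
    (hw j).differentiableOn (by norm_num)
  have hl0 j : (0 : ℝ) ∈ Icc 0 (l j) := left_mem_Icc.2 (hl j).le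
  have hll j : l j ∈ Icc 0 (l j) := right_mem_Icc.2 (hl j).le
  have ht0 : t₀ ∈ Icc t₀ T := left_mem_Icc.2 hT.le
  have hM : 0 ≤ M := (abs_nonneg _).trans (hq k 0 (hl0 k))
  set φ : ℝ → ℝ := fun t => Real.exp (-(2 + M) * (t - t₀)) with hφ
  set e : Fin n → ℝ × ℝ → ℝ := fun j => energyDensity (Icc 0 (l j) ×ˢ Icc t₀ T) (w j) with he
  set p : Fin n → ℝ × ℝ → ℝ := fun j => energyFlux (Icc 0 (l j) ×ˢ Icc t₀ T) (w j) with hp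
  have hbal j : (∫ x in (0)..(l j), φ τ * e j (x, τ)) - (∫ x in (0)..(l j), e j (x, t₀)) +
      (∫ t in t₀..τ, φ t * p j (l j, t)) - (∫ t in t₀..τ, φ t * p j (0, t))
        ≤ ε ^ 2 * (l j * (τ - t₀)) :=
    weighted_energy_le (hl j) hT (hw j) (hq j) (hwave j) ⟨hτ0, hτ.2⟩
  -- the initial energy vanishes
  have hB j : ∫ x in (0)..(l j), e j (x, t₀) = 0 := by
    rw [intervalIntegral.integral_congr (g := fun _ => 0), intervalIntegral.integral_zero]
    intro y hy
    rw [uIcc_of_le (hl j).le] at hy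
    have h₁ : partialFst (Icc 0 (l j) ×ˢ Icc t₀ T) (w j) (y, t₀) = 0 := by
      rw [← derivWithin_eq_partialFst (hl j) (hd j) hy ht0,
        derivWithin_congr (f := fun _ => (0 : E)) (fun z hz => hinit j z hz) (hinit j y hy)]
      simp
    have h₂ : partialSnd (Icc 0 (l j) ×ˢ Icc t₀ T) (w j) (y, t₀) = 0 := by
      rw [← derivWithin_eq_partialSnd hT (hd j) hy ht0, hinit' j y hy]
    simp only [he, energyDensity, h₁, h₂, hinit j y hy]
    simp
  -- no flux through the leaves
  have hPl j : ∫ t in t₀..τ, φ t * p j (l j, t) = 0 := by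
    rw [intervalIntegral.integral_congr (g := fun _ => 0), intervalIntegral.integral_zero]
    intro t ht
    rw [uIcc_of_le hτ.1] at ht
    have ht' : t ∈ Icc t₀ T := ⟨ht.1, ht.2.trans hτ.2⟩
    have h₂ : partialSnd (Icc 0 (l j) ×ˢ Icc t₀ T) (w j) (l j, t) = 0 := by
      rw [← derivWithin_eq_partialSnd hT (hd j) (hll j) ht',
        derivWithin_congr (f := fun _ => (0 : E)) (fun z hz => hdir j z hz) (hdir j t ht')]
      simp
    simp only [hp, energyFlux, h₂, inner_zero_right, mul_zero]
  -- no total flux through the center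
  have hP0 : ∑ j, ∫ t in t₀..τ, φ t * p j (0, t) = 0 := by
    rw [← intervalIntegral.integral_finsetSum]
    · rw [intervalIntegral.integral_congr (g := fun _ => 0), intervalIntegral.integral_zero]
      intro t ht
      rw [uIcc_of_le hτ.1] at ht
      have ht' : t ∈ Icc t₀ T := ⟨ht.1, ht.2.trans hτ.2⟩
      have h₂ j : partialSnd (Icc 0 (l j) ×ˢ Icc t₀ T) (w j) (0, t)
          = derivWithin (fun s => w k (0, s)) (Icc t₀ T) t := by
        rw [← derivWithin_eq_partialSnd hT (hd j) (hl0 j) ht']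
        exact derivWithin_congr (fun s hs => hcont j k s hs) (hcont j k t ht')
      have h₁ : ∑ j, partialFst (Icc 0 (l j) ×ˢ Icc t₀ T) (w j) (0, t) = 0 := by
        rw [← hkir t ht']
        exact Finset.sum_congr rfl fun j _ =>
          (derivWithin_eq_partialFst (hl j) (hd j) (hl0 j) ht').symm
      simp only [hp, energyFlux, h₂]
      rw [← Finset.mul_sum, ← Finset.mul_sum, ← sum_inner, h₁, inner_zero_left, mul_zero,
        mul_zero]
    · intro j _
      refine ContinuousOn.intervalIntegrable ?_
      rw [uIcc_of_le hτ.1]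
      refine (by fun_prop : ContinuousOn φ (Icc t₀ τ)).mul ?_
      exact (contDiffOn_energyFlux (hl j) hT (hw j)).continuousOn.comp (by fun_prop)
        fun t ht => ⟨hl0 j, ht.1, ht.2.trans hτ.2⟩
  have htot : ∑ j, ∫ x in (0)..(l j), φ τ * e j (x, τ) ≤ ε ^ 2 * ((∑ j, l j) * (τ - t₀)) := by
    have h := Finset.sum_le_sum fun j (_ : j ∈ Finset.univ) => hbal j
    rw [Finset.sum_sub_distrib, hP0, sub_zero] at h
    simp only [hPl, hB, sub_zero, add_zero] at h
    rwa [← Finset.mul_sum, ← Finset.sum_mul] at h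
  have he0 j y : 0 ≤ e j y := by simp only [he, energyDensity]; positivity
  have hk : ∫ x in (0)..(l k), φ τ * e k (x, τ) ≤ ε ^ 2 * ((∑ j, l j) * (T - t₀)) := by
    refine (Finset.single_le_sum (f := fun j => ∫ x in (0)..(l j), φ τ * e j (x, τ))
      (fun j _ => ?_) (Finset.mem_univ k)).trans (htot.trans ?_)
    · exact intervalIntegral.integral_nonneg (hl j).le
        fun y _ => mul_nonneg (Real.exp_pos _).le (he0 j _)
    · gcongr
      exact hτ.2
  rw [intervalIntegral.integral_const_mul] at hk
  have hexp : Real.exp ((2 + M) * (T - t₀)) * φ τ ≥ 1 := by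
    rw [hφ, ge_iff_le, ← Real.exp_add]
    refine Real.one_le_exp ?_
    nlinarith [hτ.2]
  have hcont_e : ContinuousOn (fun y => e k (y, τ)) (Icc 0 (l k)) :=
    (contDiffOn_energyDensity (hl k) hT (hw k)).continuousOn.comp (by fun_prop)
      fun y hy => ⟨hy, hτ⟩
  have hux : ContinuousOn
      (fun y => partialFst (Icc 0 (l k) ×ˢ Icc t₀ T) (w k) (y, τ)) (Icc 0 (l k)) :=
    (contDiffOn_partialFst (hl k) hT (hw k)).continuousOn.comp (by fun_prop)
      fun y hy => ⟨hy, hτ⟩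
  have hmono : ∫ y in (0)..(l k), ‖partialFst (Icc 0 (l k) ×ˢ Icc t₀ T) (w k) (y, τ)‖ ^ 2
      ≤ ∫ y in (0)..(l k), e k (y, τ) := by
    refine intervalIntegral.integral_mono_on (hl k).le ?_ ?_ fun y _ => ?_
    · exact ContinuousOn.intervalIntegrable (by
        rw [uIcc_of_le (hl k).le]; exact hux.norm.pow 2)
    · exact ContinuousOn.intervalIntegrable (by rw [uIcc_of_le (hl k).le]; exact hcont_e)
    · simp only [he, energyDensity]
      nlinarith [sq_nonneg ‖partialSnd (Icc 0 (l k) ×ˢ Icc t₀ T) (w k) (y, τ)‖,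
        sq_nonneg ‖w k (y, τ)‖]
  have hI0 : 0 ≤ ∫ y in (0)..(l k), e k (y, τ) :=
    intervalIntegral.integral_nonneg (hl k).le fun y _ => he0 k _
  calc ‖w k (x, τ)‖ ^ 2
      ≤ l k * ∫ y in (0)..(l k), ‖partialFst (Icc 0 (l k) ×ˢ Icc t₀ T) (w k) (y, τ)‖ ^ 2 :=
        norm_sq_le_mul_integral_norm_deriv_sq (hl k)
          (fun y hy => hasDerivWithinAt_partialFst (hd k) hy hτ) hux (hdir k τ hτ) hx
    _ ≤ l k * ((Real.exp ((2 + M) * (T - t₀)) * φ τ) * ∫ y in (0)..(l k), e k (y, τ)) := by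
        refine mul_le_mul_of_nonneg_left (hmono.trans ?_) (hl k).le
        exact le_mul_of_one_le_left hI0 hexp
    _ ≤ _ := by
        rw [mul_assoc (Real.exp _)]
        exact mul_le_mul_of_nonneg_left
          (mul_le_mul_of_nonneg_left hk (Real.exp_pos _).le) (hl k).le

end StarEnergy

/-! ### The profile and its primitives -/

section Profile

lemma contDiff_goProfile {b h : ℝ} {χ : ℝ → ℝ} (hχ : IsCutoff b χ) {m : ℕ} :
    ContDiff ℝ m (goProfile h χ) := by
  have h₁ : ContDiff ℝ m (fun s : ℝ => (s : ℂ)) := Complex.ofRealCLM.contDiff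
  have h₂ : ContDiff ℝ m (fun s : ℝ => (χ s : ℂ)) :=
    Complex.ofRealCLM.contDiff.comp (hχ.smooth.of_le (mod_cast le_top))
  exact ((contDiff_const.mul h₁).div_const _).cexp.mul h₂

lemma goProfile_eq_zero {b h : ℝ} {χ : ℝ → ℝ} (hχ : IsCutoff b χ) {s : ℝ} (hs : s ≤ 0) :
    goProfile h χ s = 0 := by
  simp [goProfile, hχ.eq_zero s fun hs' => hs.not_gt hs'.1]

/-- The primitive of `f` that vanishes at `0`. -/
noncomputable def primitive (f : ℝ → ℂ) (s : ℝ) : ℂ := ∫ σ in (0)..s, f σ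

lemma hasDerivAt_primitive {f : ℝ → ℂ} (hf : Continuous f) (s : ℝ) :
    HasDerivAt (primitive f) (f s) s :=
  intervalIntegral.integral_hasDerivAt_right (hf.intervalIntegrable _ _)
    (hf.stronglyMeasurableAtFilter _ _) hf.continuousAt

lemma contDiff_primitive {f : ℝ → ℂ} {m : ℕ} (hf : ContDiff ℝ m f) :
    ContDiff ℝ (m + 1) (primitive f) := by
  rw [contDiff_succ_iff_deriv]
  refine ⟨fun s => (hasDerivAt_primitive hf.continuous s).differentiableAt, by simp, ?_⟩
  rwa [show deriv (primitive f) = f from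
    funext fun s => (hasDerivAt_primitive hf.continuous s).deriv]

lemma primitive_eq_zero {f : ℝ → ℂ} (hf : ∀ s ≤ 0, f s = 0) : ∀ s ≤ 0, primitive f s = 0 := by
  intro s hs
  rw [primitive, intervalIntegral.integral_congr (g := fun _ => 0),
    intervalIntegral.integral_zero]
  intro σ hσ
  rw [uIcc_of_ge hs] at hσ
  exact hf σ hσ.2

lemma deriv_eq_zero_of_nonpos {f : ℝ → ℂ} (hd : Differentiable ℝ f) (hf : ∀ s ≤ 0, f s = 0) :
    ∀ s ≤ 0, deriv f s = 0 := by
  intro s hs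
  have h₁ : HasDerivWithinAt f (deriv f s) (Iic s) s := (hd s).hasDerivAt.hasDerivWithinAt
  have h₂ : HasDerivWithinAt f 0 (Iic s) s :=
    (hasDerivWithinAt_const s (Iic s) (0 : ℂ)).congr (fun y hy => hf y (le_trans hy hs)) (hf s hs)
  exact (uniqueDiffWithinAt_Iic s).eq_deriv _ h₁ h₂

lemma norm_primitive_le {f : ℝ → ℂ} {K L s : ℝ} (hf : ∀ σ, |σ| ≤ L → ‖f σ‖ ≤ K)
    (hs : |s| ≤ L) : ‖primitive f s‖ ≤ K * L := by
  have hK : 0 ≤ K := (norm_nonneg _).trans (hf s hs)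
  refine (intervalIntegral.norm_integral_le_of_norm_le_const (C := K) fun σ hσ => ?_).trans ?_
  · refine hf σ (le_trans ?_ hs)
    have := abs_sub_left_of_mem_uIcc (uIoc_subset_uIcc hσ)
    simpa using this
  · rw [sub_zero]; gcongr

/-- Oscillation gains one power of `h`: integrating by parts against `exp (i s / h)`, the primitive
of the profile is `O(h)`, uniformly on bounded sets. -/
lemma exists_norm_primitive_goProfile_le {b : ℝ} {χ : ℝ → ℝ} (hχ : IsCutoff b χ) (L : ℝ) :
    ∃ K : ℝ, 0 ≤ K ∧ ∀ h : ℝ, 0 < h → ∀ s, |s| ≤ L → ‖primitive (goProfile h χ) s‖ ≤ K * h := by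
  have hχ1 : ContDiff ℝ 1 χ := hχ.smooth.of_le (mod_cast le_top)
  have hχ' : Continuous (deriv χ) := hχ1.continuous_deriv le_rfl
  obtain ⟨K₀, hK₀⟩ := (isCompact_Icc (a := -L) (b := L)).exists_bound_of_continuousOn
    hχ1.continuous.continuousOn
  obtain ⟨K₁, hK₁⟩ := (isCompact_Icc (a := -L) (b := L)).exists_bound_of_continuousOn
    hχ'.continuousOn
  refine ⟨|K₀| + |K₁| * |L|, by positivity, fun h hh s hs => ?_⟩
  have hh' : (h : ℂ) ≠ 0 := by exact_mod_cast hh.ne'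
  set ψ : ℝ → ℂ := fun σ => Complex.exp (Complex.I * σ / h) with hψ
  have hψn σ : ‖ψ σ‖ = 1 := by
    simp only [hψ]
    rw [show Complex.I * (σ : ℂ) / h = ((σ / h : ℝ) : ℂ) * Complex.I by push_cast; ring]
    exact Complex.norm_exp_ofReal_mul_I _
  have hψd σ : HasDerivAt (fun σ => -(h : ℂ) * Complex.I * ψ σ) (ψ σ) σ := by
    have := ((((hasDerivAt_id σ).ofReal_comp.const_mul Complex.I).div_const (h : ℂ)).cexp).const_mul
      (-(h : ℂ) * Complex.I)
    refine this.congr_deriv ?_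
    simp only [hψ, id, Complex.ofReal_one]
    field_simp
    rw [Complex.I_sq]
    ring
  have hψc : Continuous ψ := by fun_prop
  have hχd σ : HasDerivAt (fun σ => (χ σ : ℂ)) ((deriv χ σ : ℝ) : ℂ) σ :=
    ((hχ1.differentiable one_ne_zero) σ).hasDerivAt.ofReal_comp
  have hparts : primitive (goProfile h χ) s
      = (χ s : ℂ) * (-(h : ℂ) * Complex.I * ψ s)
        - ∫ σ in (0)..s, ((deriv χ σ : ℝ) : ℂ) * (-(h : ℂ) * Complex.I * ψ σ) := by
    have := intervalIntegral.integral_mul_deriv_eq_deriv_mul (a := 0) (b := s)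
      (fun σ _ => hχd σ) (fun σ _ => hψd σ)
      ((Complex.continuous_ofReal.comp hχ').intervalIntegrable _ _) (hψc.intervalIntegrable _ _)
    rw [hχ.eq_zero 0 (by simp), Complex.ofReal_zero, zero_mul, sub_zero] at this
    rw [← this, primitive]
    simp only [goProfile, hψ, mul_comm]
  have hn (z : ℂ) (σ : ℝ) : ‖z * (-(h : ℂ) * Complex.I * ψ σ)‖ = ‖z‖ * h := by
    simp [hψn, abs_of_pos hh]
  have hint : ‖∫ σ in (0)..s, ((deriv χ σ : ℝ) : ℂ) * (-(h : ℂ) * Complex.I * ψ σ)‖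
      ≤ |K₁| * h * L := by
    refine norm_primitive_le (fun σ hσ => ?_) hs
    rw [hn, Complex.norm_real]
    gcongr
    exact (hK₁ σ (abs_le.1 hσ)).trans (le_abs_self _)
  rw [hparts]
  refine (norm_sub_le _ _).trans ?_
  rw [hn, Complex.norm_real]
  have := (hK₀ s (abs_le.1 hs)).trans (le_abs_self _)
  rw [abs_of_nonneg ((abs_nonneg s).trans hs)]
  nlinarith

end Profile

/-! ### Antiderivatives of the potential -/

section Potential

/-- An antiderivative of a `C¹` potential on `[0, a]`, extended to a `C²` function on the line. -/
lemma exists_contDiff_antiderivative {a M : ℝ} (ha : 0 < a) {q : ℝ → ℝ}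
    (hq : ContDiffOn ℝ 1 q (Icc 0 a)) (hM : ∀ x ∈ Icc 0 a, |q x| ≤ M)
    (hM' : ∀ x ∈ Icc 0 a, |derivWithin q (Icc 0 a) x| ≤ M) :
    ∃ Q r r' : ℝ → ℝ, ContDiff ℝ 2 Q ∧ (∀ x, HasDerivAt Q (r x) x) ∧
      (∀ x, HasDerivAt r (r' x) x) ∧ Q 0 = 0 ∧ (∀ x ∈ Icc 0 a, r x = q x) ∧
      (∀ x ∈ Icc 0 a, |r' x| ≤ M) ∧ (∀ x ∈ Icc 0 a, |Q x| ≤ M * a) := by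
  have h0 : (0 : ℝ) ∈ Icc 0 a := left_mem_Icc.2 ha.le
  have hM0 : 0 ≤ M := (abs_nonneg _).trans (hM 0 h0)
  have hc : ContinuousOn (derivWithin q (Icc 0 a)) (Icc 0 a) :=
    hq.continuousOn_derivWithin (uniqueDiffOn_Icc ha) le_rfl
  set g : ℝ → ℝ := IccExtend ha.le ((Icc 0 a).domRestrict (derivWithin q (Icc 0 a))) with hg
  have hgc : Continuous g := hc.domRestrict.Icc_extend'
  have hgq : ∀ x ∈ Icc 0 a, g x = derivWithin q (Icc 0 a) x := fun x hx => by
    rw [hg, IccExtend_of_mem ha.le _ hx, domRestrict_apply]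
  set r : ℝ → ℝ := fun x => q 0 + ∫ y in (0)..x, g y with hr
  have hrd x : HasDerivAt r (g x) x := (hgc.integral_hasStrictDerivAt 0 x).hasDerivAt.const_add _
  have hrc : Continuous r := continuous_iff_continuousAt.2 fun x => (hrd x).continuousAt
  have hrq : ∀ x ∈ Icc 0 a, r x = q x := by
    intro x hx
    have hcx : ContinuousOn q (Icc 0 x) := hq.continuousOn.mono (Icc_subset_Icc_right hx.2)
    have := intervalIntegral.integral_eq_sub_of_hasDerivAt_of_le hx.1 hcx (f' := g)
      (fun y hy => ?_) (hgc.intervalIntegrable _ _)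
    · simp only [hr, this]; ring
    · have hy' : y ∈ Ioo 0 a := ⟨hy.1, hy.2.trans_le hx.2⟩
      rw [hgq y (Ioo_subset_Icc_self hy')]
      exact ((hq.differentiableOn one_ne_zero) y
        (Ioo_subset_Icc_self hy')).hasDerivWithinAt.hasDerivAt (Icc_mem_nhds hy'.1 hy'.2)
  have hQd x : HasDerivAt (fun x => ∫ y in (0)..x, r y) (r x) x :=
    (hrc.integral_hasStrictDerivAt 0 x).hasDerivAt
  have hr1 : ContDiff ℝ 1 r :=
    contDiff_one_iff_deriv.2 ⟨fun x => (hrd x).differentiableAt, by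
      rwa [show deriv r = g from funext fun x => (hrd x).deriv]⟩
  refine ⟨fun x => ∫ y in (0)..x, r y, r, g, ?_, hQd, hrd, by simp, hrq, ?_, ?_⟩
  · rw [show (2 : WithTop ℕ∞) = 1 + 1 by norm_num, contDiff_succ_iff_deriv]
    refine ⟨fun x => (hQd x).differentiableAt, by simp, ?_⟩
    rwa [show deriv (fun x => ∫ y in (0)..x, r y) = r from funext fun x => (hQd x).deriv]
  · intro x hx
    rw [hgq x hx]
    exact hM' x hx
  · intro x hx
    rw [← Real.norm_eq_abs]
    refine (intervalIntegral.norm_integral_le_of_norm_le_const (C := M) fun y hy => ?_).trans ?_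
    · rw [uIoc_of_le hx.1] at hy
      have hy' : y ∈ Icc 0 a := ⟨hy.1.le, hy.2.trans hx.2⟩
      rw [hrq y hy', Real.norm_eq_abs]
      exact hM y hy'
    · rw [sub_zero, abs_of_nonneg hx.1]
      gcongr
      exact hx.2

end Potential

/-! ### The second-order ansatz on one edge -/

section Ansatz

/-- The ansatz `α f(t + x) + β f(t - x) + A(x) F(t + x) + B(x) F(t - x) + c G(t - x)` at
`p = (x, t)`, with `F` the primitive of `f` and `G` the primitive of `F`: an incoming and an
outgoing wave, their correctors of first order, and a wave of second order that removes the
remaining flux at the center. -/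
noncomputable def waveAnsatz (f : ℝ → ℂ) (α β c : ℂ) (A B : ℝ → ℂ) (p : ℝ × ℝ) : ℂ :=
  α * f (p.2 + p.1) + β * f (p.2 - p.1) + A p.1 * primitive f (p.2 + p.1)
    + B p.1 * primitive f (p.2 - p.1) + c * primitive (primitive f) (p.2 - p.1)

variable {f : ℝ → ℂ} {α β c : ℂ} {A B : ℝ → ℂ}

lemma contDiff_waveAnsatz (hf : ContDiff ℝ 2 f) (hA : ContDiff ℝ 2 A) (hB : ContDiff ℝ 2 B) :
    ContDiff ℝ 2 (waveAnsatz f α β c A B) := by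
  have hF : ContDiff ℝ 2 (primitive f) := (contDiff_primitive (m := 2) hf).of_le (by norm_num)
  have hG : ContDiff ℝ 2 (primitive (primitive f)) :=
    (contDiff_primitive (m := 2) hF).of_le (by norm_num)
  have hp : ContDiff ℝ 2 fun p : ℝ × ℝ => p.2 + p.1 := contDiff_snd.add contDiff_fst
  have hm : ContDiff ℝ 2 fun p : ℝ × ℝ => p.2 - p.1 := contDiff_snd.sub contDiff_fst
  exact ((((contDiff_const.mul (hf.comp hp)).add (contDiff_const.mul (hf.comp hm))).add
    ((hA.comp contDiff_fst).mul (hF.comp hp))).add ((hB.comp contDiff_fst).mul (hF.comp hm))).add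
    (contDiff_const.mul (hG.comp hm))

lemma hasDerivAt_waveAnsatz_snd (hf : ContDiff ℝ 2 f) (x t : ℝ) :
    HasDerivAt (fun s => waveAnsatz f α β c A B (x, s))
      (α * deriv f (t + x) + β * deriv f (t - x) + A x * f (t + x) + B x * f (t - x)
        + c * primitive f (t - x)) t := by
  have hFc : Continuous (primitive f) :=
    continuous_iff_continuousAt.2 fun s => (hasDerivAt_primitive hf.continuous s).continuousAt
  have hfd s : HasDerivAt f (deriv f s) s := (hf.differentiable two_ne_zero s).hasDerivAt
  exact ((((((hfd (t + x)).comp_add_const t x).const_mul α).add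
    (((hfd (t - x)).comp_sub_const t x).const_mul β)).add
    (((hasDerivAt_primitive hf.continuous (t + x)).comp_add_const t x).const_mul (A x))).add
    (((hasDerivAt_primitive hf.continuous (t - x)).comp_sub_const t x).const_mul (B x))).add
    (((hasDerivAt_primitive hFc (t - x)).comp_sub_const t x).const_mul c)

lemma iteratedDeriv_two_waveAnsatz_snd (hf : ContDiff ℝ 2 f) (x t : ℝ) :
    iteratedDeriv 2 (fun s => waveAnsatz f α β c A B (x, s)) t
      = α * deriv (deriv f) (t + x) + β * deriv (deriv f) (t - x) + A x * deriv f (t + x)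
        + B x * deriv f (t - x) + c * f (t - x) := by
  have hfd s : HasDerivAt f (deriv f s) s := (hf.differentiable two_ne_zero s).hasDerivAt
  have hfd' s : HasDerivAt (deriv f) (deriv (deriv f) s) s :=
    ((ContDiff.deriv' (n := 1) (hf.of_le (by norm_num))).differentiable one_ne_zero s).hasDerivAt
  have hfirst : (deriv fun s => waveAnsatz f α β c A B (x, s)) = _ :=
    funext fun s => (hasDerivAt_waveAnsatz_snd hf x s).deriv
  rw [iteratedDeriv_succ, iteratedDeriv_one, hfirst]
  exact ((((((hfd' (t + x)).comp_add_const t x).const_mul α).add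
    (((hfd' (t - x)).comp_sub_const t x).const_mul β)).add
    (((hfd (t + x)).comp_add_const t x).const_mul (A x))).add
    (((hfd (t - x)).comp_sub_const t x).const_mul (B x))).add
    (((hasDerivAt_primitive hf.continuous (t - x)).comp_sub_const t x).const_mul c) |>.deriv

lemma hasDerivAt_waveAnsatz_fst (hf : ContDiff ℝ 2 f) {A' B' : ℂ} {x : ℝ}
    (hA : HasDerivAt A A' x) (hB : HasDerivAt B B' x) (t : ℝ) :
    HasDerivAt (fun y => waveAnsatz f α β c A B (y, t))
      (α * deriv f (t + x) - β * deriv f (t - x) + A' * primitive f (t + x) + A x * f (t + x)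
        + B' * primitive f (t - x) - B x * f (t - x) - c * primitive f (t - x)) x := by
  have hFc : Continuous (primitive f) :=
    continuous_iff_continuousAt.2 fun s => (hasDerivAt_primitive hf.continuous s).continuousAt
  have hfd s : HasDerivAt f (deriv f s) s := (hf.differentiable two_ne_zero s).hasDerivAt
  have hF s := hasDerivAt_primitive hf.continuous s
  refine ((((((hfd (t + x)).comp_const_add t x).const_mul α).add
    (((hfd (t - x)).comp_const_sub t x).const_mul β)).add
    (hA.mul ((hF (t + x)).comp_const_add t x))).add
    (hB.mul ((hF (t - x)).comp_const_sub t x))).add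
    (((hasDerivAt_primitive hFc (t - x)).comp_const_sub t x).const_mul c) |>.congr_deriv ?_
  ring

lemma iteratedDeriv_two_waveAnsatz_fst (hf : ContDiff ℝ 2 f) {A' B' : ℝ → ℂ} {A'' B'' : ℂ} {x : ℝ}
    (hA : ∀ y, HasDerivAt A (A' y) y) (hB : ∀ y, HasDerivAt B (B' y) y)
    (hA' : HasDerivAt A' A'' x) (hB' : HasDerivAt B' B'' x) (t : ℝ) :
    iteratedDeriv 2 (fun y => waveAnsatz f α β c A B (y, t)) x
      = α * deriv (deriv f) (t + x) + β * deriv (deriv f) (t - x)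
        + A'' * primitive f (t + x) + 2 * A' x * f (t + x) + A x * deriv f (t + x)
        + B'' * primitive f (t - x) - 2 * B' x * f (t - x) + B x * deriv f (t - x)
        + c * f (t - x) := by
  have hfd s : HasDerivAt f (deriv f s) s := (hf.differentiable two_ne_zero s).hasDerivAt
  have hfd' s : HasDerivAt (deriv f) (deriv (deriv f) s) s :=
    ((ContDiff.deriv' (n := 1) (hf.of_le (by norm_num))).differentiable one_ne_zero s).hasDerivAt
  have hF s := hasDerivAt_primitive hf.continuous s
  have hfirst : (deriv fun y => waveAnsatz f α β c A B (y, t)) = _ :=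
    funext fun y => (hasDerivAt_waveAnsatz_fst hf (hA y) (hB y) t).deriv
  rw [iteratedDeriv_succ, iteratedDeriv_one, hfirst]
  refine ((((((((hfd' (t + x)).comp_const_add t x).const_mul α).sub
    (((hfd' (t - x)).comp_const_sub t x).const_mul β)).add
    (hA'.mul ((hF (t + x)).comp_const_add t x))).add
    ((hA x).mul ((hfd (t + x)).comp_const_add t x))).add
    (hB'.mul ((hF (t - x)).comp_const_sub t x))).sub
    ((hB x).mul ((hfd (t - x)).comp_const_sub t x))).sub
    (((hF (t - x)).comp_const_sub t x).const_mul c) |>.deriv.trans ?_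
  ring

/-- If the amplitudes solve the transport equations `2 A' = α q` and `2 B' = -β q`, then only
terms with a primitive of `f` remain in the wave equation for the ansatz. -/
lemma waveAnsatz_residual (hf : ContDiff ℝ 2 f) {A' B' : ℝ → ℂ} {A'' B'' q : ℂ} {x : ℝ}
    (hA : ∀ y, HasDerivAt A (A' y) y) (hB : ∀ y, HasDerivAt B (B' y) y)
    (hA' : HasDerivAt A' A'' x) (hB' : HasDerivAt B' B'' x)
    (hAq : 2 * A' x = α * q) (hBq : 2 * B' x = -(β * q)) (t : ℝ) :
    iteratedDeriv 2 (fun s => waveAnsatz f α β c A B (x, s)) t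
        - iteratedDeriv 2 (fun y => waveAnsatz f α β c A B (y, t)) x
        + q * waveAnsatz f α β c A B (x, t)
      = (q * A x - A'') * primitive f (t + x) + (q * B x - B'') * primitive f (t - x)
        + q * c * primitive (primitive f) (t - x) := by
  rw [iteratedDeriv_two_waveAnsatz_snd hf, iteratedDeriv_two_waveAnsatz_fst hf hA hB hA' hB',
    waveAnsatz]
  linear_combination (-f (t + x)) * hAq + f (t - x) * hBq

end Ansatz

/-! ### Amplitudes on the star graph -/

section Amplitudes

variable {n : ℕ} [NeZero n]

/-- The amplitude of the incoming wave on the `j`-th edge. -/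
noncomputable def inAmplitude (j : Fin n) : ℝ := if j = 0 then 1 else 0

/-- The amplitude of the outgoing wave on the `j`-th edge: the reflection coefficient `2 / n - 1`
on the edge with index `0`, and the transmission coefficient `2 / n` on all others. -/
noncomputable def outAmplitude (j : Fin n) : ℝ := 2 / n - inAmplitude j

lemma abs_inAmplitude_le (j : Fin n) : |inAmplitude j| ≤ 1 := by
  unfold inAmplitude; split_ifs <;> simp

lemma abs_outAmplitude_le (j : Fin n) : |outAmplitude j| ≤ 2 := by
  have hn : (1 : ℝ) ≤ n := by exact_mod_cast Nat.one_le_iff_ne_zero.2 (NeZero.ne n)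
  have h₁ : 2 / (n : ℝ) ≤ 2 := div_le_self (by norm_num) hn
  have h₂ : 0 ≤ 2 / (n : ℝ) := by positivity
  unfold outAmplitude inAmplitude
  split_ifs <;> rw [abs_le] <;> constructor <;> linarith

lemma inAmplitude_of_ne_zero {j : Fin n} (hj : j ≠ 0) : inAmplitude j = 0 := if_neg hj

lemma inAmplitude_add_outAmplitude (j : Fin n) : inAmplitude j + outAmplitude j = 2 / n := by
  unfold outAmplitude; ring

lemma sum_inAmplitude_sub_outAmplitude :
    ∑ j : Fin n, (inAmplitude j - outAmplitude j) = 0 := by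
  have hn : (n : ℝ) ≠ 0 := NeZero.ne _
  have : ∑ j : Fin n, inAmplitude j = 1 := by simp [inAmplitude]
  simp only [outAmplitude, Finset.sum_sub_distrib, this, Finset.sum_const, Finset.card_univ,
    Fintype.card_fin, nsmul_eq_mul]
  field_simp
  ring

/-- Amplitudes `A`, `B` of the incoming and outgoing first-order correctors on the star graph, with
derivatives `A'`, `B'`, and the amplitude `c` of the second-order wave. They solve the transport
equations, and they are matched at the center and at the leaves so that the ansatz satisfies all
boundary conditions exactly: `flux₀` and `flux₁` say that the coefficients of `f(t)` and of its
primitive in the Kirchhoff–Neumann condition vanish. The bounds are in terms of a bound `m` for the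
potential. -/
structure IsStarAmplitudes (l : Fin n → ℝ) (q : Fin n → ℝ → ℝ) (m : ℝ)
    (A B A' B' : Fin n → ℝ → ℂ) (c : ℂ) : Prop where
  contDiff_in : ∀ j, ContDiff ℝ 2 (A j)
  contDiff_out : ∀ j, ContDiff ℝ 2 (B j)
  hasDerivAt_in : ∀ j x, HasDerivAt (A j) (A' j x) x
  hasDerivAt_out : ∀ j x, HasDerivAt (B j) (B' j x) x
  transport_in : ∀ j, ∀ x ∈ Icc 0 (l j), 2 * A' j x = inAmplitude j * q j x
  transport_out : ∀ j, ∀ x ∈ Icc 0 (l j), 2 * B' j x = -(outAmplitude j * q j x)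
  exists_deriv₂ : ∀ j, ∀ x ∈ Icc 0 (l j), ∃ A'' B'' : ℂ, HasDerivAt (A' j) A'' x ∧
    HasDerivAt (B' j) B'' x ∧ ‖A''‖ ≤ m ∧ ‖B''‖ ≤ m
  leaf : ∀ j, A j (l j) = 0
  eq_zero : ∀ j, j ≠ 0 → ∀ x, A j x = 0
  continuity : ∀ j k, A j 0 + B j 0 = A k 0 + B k 0
  flux₀ : ∑ j, (A j 0 - B j 0) = 0
  flux₁ : ∑ j, (A' j 0 + B' j 0) = n * c
  norm_in_le : ∀ j, ∀ x ∈ Icc 0 (l j), ‖A j x‖ ≤ m * ∑ k, l k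
  norm_out_le : ∀ j, ∀ x ∈ Icc 0 (l j), ‖B j x‖ ≤ 2 * (m * ∑ k, l k)
  norm_c_le : ‖c‖ ≤ 2 * m

lemma exists_isStarAmplitudes {l : Fin n → ℝ} (hl : ∀ j, 0 < l j) {q : Fin n → ℝ → ℝ} {m : ℝ}
    (hq : IsC1PotentialWithBound l m q) :
    ∃ A B A' B' c, IsStarAmplitudes l q m A B A' B' c := by
  have hn : (n : ℝ) ≠ 0 := NeZero.ne _
  have hm : 0 ≤ m := (abs_nonneg _).trans (hq.abs_le 0 0 (left_mem_Icc.2 (hl 0).le))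
  choose Q r r' hQc hQ hr hQ0 hrq hr' hQb using fun j =>
    exists_contDiff_antiderivative (hl j) (hq.contDiffOn j) (hq.abs_le j) (hq.abs_deriv_le j)
  have hlL j : l j ≤ ∑ k, l k :=
    Finset.single_le_sum (f := l) (fun k _ => (hl k).le) (Finset.mem_univ j)
  have hQL j x (hx : x ∈ Icc 0 (l j)) : |Q j x| ≤ m * ∑ k, l k :=
    (hQb j x hx).trans (mul_le_mul_of_nonneg_left (hlL j) hm)
  set L := ∑ k, l k
  set κ : ℝ := -(Q 0 (l 0) / 2) with hκ
  have hκb : |κ| ≤ m * L / 2 := by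
    have := abs_le.1 (hQL 0 (l 0) (right_mem_Icc.2 (hl 0).le))
    rw [hκ, abs_le]; constructor <;> linarith
  set c : ℝ := (∑ j, (inAmplitude j - outAmplitude j) / 2 * q j 0) / n with hc
  have hA0 j : inAmplitude j * ((Q j 0 - Q j (l j)) / 2) = inAmplitude j * κ := by
    by_cases hj : j = 0
    · subst hj; rw [hκ, hQ0]; ring
    · rw [inAmplitude_of_ne_zero hj]; ring
  have hB0 j : outAmplitude j * (κ - Q j 0 / 2) = outAmplitude j * κ := by rw [hQ0]; ring
  refine ⟨fun j x => ((inAmplitude j * ((Q j x - Q j (l j)) / 2) : ℝ) : ℂ),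
    fun j x => ((outAmplitude j * (κ - Q j x / 2) : ℝ) : ℂ),
    fun j x => ((inAmplitude j * (r j x / 2) : ℝ) : ℂ),
    fun j x => ((outAmplitude j * -(r j x / 2) : ℝ) : ℂ), c, ?_⟩
  constructor
  · exact fun j => Complex.ofRealCLM.contDiff.comp
      (contDiff_const.mul (((hQc j).sub contDiff_const).div_const _))
  · exact fun j => Complex.ofRealCLM.contDiff.comp
      (contDiff_const.mul (contDiff_const.sub ((hQc j).div_const _)))
  · exact fun j x => ((((hQ j x).sub_const _).div_const 2).const_mul _).ofReal_comp
  · exact fun j x => ((((hQ j x).div_const 2).const_sub κ).const_mul _).ofReal_comp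
  · intro j x hx
    rw [hrq j x hx]; push_cast; ring
  · intro j x hx
    rw [hrq j x hx]; push_cast; ring
  · intro j x hx
    have hb := abs_le.1 (hr' j x hx)
    have hhalf : |r' j x / 2| ≤ m / 2 := by rw [abs_le]; constructor <;> linarith
    refine ⟨_, _, (((hr j x).div_const 2).const_mul _).ofReal_comp,
      ((((hr j x).div_const 2).neg).const_mul _).ofReal_comp, ?_, ?_⟩
    · rw [Complex.norm_real, Real.norm_eq_abs, abs_mul]
      calc _ ≤ 1 * (m / 2) := mul_le_mul (abs_inAmplitude_le j) hhalf (abs_nonneg _) one_pos.le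
        _ ≤ m := by linarith
    · rw [Complex.norm_real, Real.norm_eq_abs, abs_mul, abs_neg]
      calc _ ≤ 2 * (m / 2) := mul_le_mul (abs_outAmplitude_le j) hhalf (abs_nonneg _) two_pos.le
        _ = m := by ring
  · intro j; simp
  · intro j hj x; simp [inAmplitude_of_ne_zero hj]
  · intro j k
    simp only [hA0, hB0]
    norm_cast
    rw [← add_mul, ← add_mul, inAmplitude_add_outAmplitude, inAmplitude_add_outAmplitude]
  · simp only [hA0, hB0]
    norm_cast
    simp_rw [← sub_mul]
    rw [← Finset.sum_mul, sum_inAmplitude_sub_outAmplitude, zero_mul]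
  · have h0 j := hrq j 0 (left_mem_Icc.2 (hl j).le)
    simp only [h0]
    norm_cast
    rw [hc, mul_div_cancel₀ _ hn]
    exact Finset.sum_congr rfl fun j _ => by ring
  · intro j x hx
    rw [Complex.norm_real, Real.norm_eq_abs, abs_mul]
    have h₁ := abs_le.1 (hQL j x hx)
    have h₂ := abs_le.1 (hQL j (l j) (right_mem_Icc.2 (hl j).le))
    have h₃ : |(Q j x - Q j (l j)) / 2| ≤ m * L := by rw [abs_le]; constructor <;> linarith
    calc _ ≤ 1 * (m * L) := mul_le_mul (abs_inAmplitude_le j) h₃ (abs_nonneg _) one_pos.le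
      _ = m * L := one_mul _
  · intro j x hx
    rw [Complex.norm_real, Real.norm_eq_abs, abs_mul]
    have h₁ := abs_le.1 (hQL j x hx)
    have h₂ := abs_le.1 hκb
    have h₃ : |κ - Q j x / 2| ≤ m * L := by rw [abs_le]; constructor <;> linarith
    exact mul_le_mul (abs_outAmplitude_le j) h₃ (abs_nonneg _) two_pos.le
  · rw [Complex.norm_real, Real.norm_eq_abs, hc, abs_div, Nat.abs_cast,
      div_le_iff₀ (by positivity)]
    calc _ ≤ ∑ j : Fin n, |(inAmplitude j - outAmplitude j) / 2 * q j 0| :=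
          Finset.abs_sum_le_sum_abs _ _
      _ ≤ ∑ _j : Fin n, 2 * m := by
          refine Finset.sum_le_sum fun j _ => ?_
          rw [abs_mul]
          have h₁ := abs_le.1 (abs_inAmplitude_le j)
          have h₂ := abs_le.1 (abs_outAmplitude_le j)
          exact mul_le_mul (abs_le.2 ⟨by linarith, by linarith⟩)
            (hq.abs_le j 0 (left_mem_Icc.2 (hl j).le)) (abs_nonneg _) two_pos.le
      _ = 2 * m * n := by simp [mul_comm]

end Amplitudes

/-! ### The ansatz on the star graph -/

section StarAnsatz

variable {n : ℕ} [NeZero n] {l : Fin n → ℝ} {q : Fin n → ℝ → ℝ} {m : ℝ}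
  {A B A' B' : Fin n → ℝ → ℂ} {c : ℂ} {f : ℝ → ℂ}

/-- The ansatz on the `j`-th edge of the star graph. -/
noncomputable def starAnsatz (f : ℝ → ℂ) (A B : Fin n → ℝ → ℂ) (c : ℂ) (j : Fin n)
    (p : ℝ × ℝ) : ℂ :=
  waveAnsatz f (inAmplitude j) (outAmplitude j) c (A j) (B j) p

namespace IsStarAmplitudes

lemma ansatz_initial (H : IsStarAmplitudes l q m A B A' B' c) (hf0 : ∀ s ≤ 0, f s = 0)
    (j : Fin n) {x : ℝ} (hx : x ∈ Icc 0 (l j)) (hl : 0 < l 0) :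
    starAnsatz f A B c j (x, -l 0) = 0 := by
  have hF0 := primitive_eq_zero hf0
  have hG0 := primitive_eq_zero hF0
  have hs : -l 0 - x ≤ 0 := by linarith [hx.1]
  simp only [starAnsatz, waveAnsatz, hf0 _ hs, hF0 _ hs, hG0 _ hs]
  by_cases hj : j = 0
  · subst hj
    have hs' : -l 0 + x ≤ 0 := by linarith [hx.2]
    simp [hf0 _ hs', hF0 _ hs']
  · simp [inAmplitude_of_ne_zero hj, H.eq_zero j hj]

lemma ansatz_initial_deriv (H : IsStarAmplitudes l q m A B A' B' c) (hf : ContDiff ℝ 2 f)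
    (hf0 : ∀ s ≤ 0, f s = 0) (j : Fin n) {x : ℝ} (hx : x ∈ Icc 0 (l j)) (hl : 0 < l 0) :
    HasDerivAt (fun s => starAnsatz f A B c j (x, s)) 0 (-l 0) := by
  have hF0 := primitive_eq_zero hf0
  have hd0 := deriv_eq_zero_of_nonpos (hf.differentiable two_ne_zero) hf0
  have hs : -l 0 - x ≤ 0 := by linarith [hx.1]
  refine (hasDerivAt_waveAnsatz_snd hf x (-l 0)).congr_deriv ?_
  simp only [hf0 _ hs, hF0 _ hs, hd0 _ hs]
  by_cases hj : j = 0
  · subst hj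
    have hs' : -l 0 + x ≤ 0 := by linarith [hx.2]
    simp [hf0 _ hs', hd0 _ hs']
  · simp [inAmplitude_of_ne_zero hj, H.eq_zero j hj]

/-- Until the time `t ≤ l j` the outgoing waves have not reached the leaf. -/
lemma ansatz_leaf (H : IsStarAmplitudes l q m A B A' B' c) (hf0 : ∀ s ≤ 0, f s = 0)
    (j : Fin n) {t : ℝ} (ht : t ≤ l j) :
    starAnsatz f A B c j (l j, t) = inAmplitude j * f (t + l j) := by
  have hF0 := primitive_eq_zero hf0
  have hG0 := primitive_eq_zero hF0
  have hs : t - l j ≤ 0 := by linarith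
  simp [starAnsatz, waveAnsatz, hf0 _ hs, hF0 _ hs, hG0 _ hs, H.leaf j]

lemma ansatz_continuity (H : IsStarAmplitudes l q m A B A' B' c) (j k : Fin n) (t : ℝ) :
    starAnsatz f A B c j (0, t) = starAnsatz f A B c k (0, t) := by
  have h : ((inAmplitude j + outAmplitude j : ℝ) : ℂ) = (inAmplitude k + outAmplitude k : ℝ) := by
    rw [inAmplitude_add_outAmplitude, inAmplitude_add_outAmplitude]
  push_cast at h
  simp only [starAnsatz, waveAnsatz, add_zero, sub_zero]
  linear_combination f t * h + primitive f t * H.continuity j k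

lemma ansatz_kirchhoff (H : IsStarAmplitudes l q m A B A' B' c) (hl : ∀ j, 0 < l j)
    (hf : ContDiff ℝ 2 f) (t : ℝ) :
    ∑ j, derivWithin (fun x => starAnsatz f A B c j (x, t)) (Icc 0 (l j)) 0 = 0 := by
  have h₀ : ∑ j : Fin n, ((inAmplitude j : ℂ) - outAmplitude j) = 0 := by
    exact_mod_cast congrArg ((↑) : ℝ → ℂ) (sum_inAmplitude_sub_outAmplitude (n := n))
  have hd j : derivWithin (fun x => starAnsatz f A B c j (x, t)) (Icc 0 (l j)) 0
      = ((inAmplitude j : ℂ) - outAmplitude j) * deriv f t + (A' j 0 + B' j 0) * primitive f t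
        + (A j 0 - B j 0) * f t - c * primitive f t := by
    have := (hasDerivAt_waveAnsatz_fst (α := inAmplitude j) (β := outAmplitude j) (c := c) hf
      (H.hasDerivAt_in j 0) (H.hasDerivAt_out j 0) t).hasDerivWithinAt.derivWithin
      (uniqueDiffOn_Icc (hl j) 0 (left_mem_Icc.2 (hl j).le))
    simp only [starAnsatz, this, add_zero, sub_zero]
    ring
  simp only [hd, Finset.sum_add_distrib, Finset.sum_sub_distrib, ← Finset.sum_mul]
  have h₁ := H.flux₀
  have h₂ := H.flux₁
  simp only [Finset.sum_add_distrib, Finset.sum_sub_distrib] at h₀ h₁ h₂ ⊢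
  simp only [Finset.sum_const, Finset.card_univ, Fintype.card_fin, nsmul_eq_mul]
  linear_combination deriv f t * h₀ + f t * h₁ + primitive f t * h₂

lemma norm_ansatz_sub_le (H : IsStarAmplitudes l q m A B A' B' c) (j : Fin n) {x t k : ℝ}
    (hx : x ∈ Icc 0 (l j)) (hp : ‖primitive f (t + x)‖ ≤ k) (hm : ‖primitive f (t - x)‖ ≤ k)
    (hg : ‖primitive (primitive f) (t - x)‖ ≤ k * (2 * ∑ j, l j)) :
    ‖starAnsatz f A B c j (x, t)
        - (inAmplitude j * f (t + x) + outAmplitude j * f (t - x))‖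
      ≤ 7 * m * (∑ j, l j) * k := by
  have hA := H.norm_in_le j x hx
  have hB := H.norm_out_le j x hx
  have hc := H.norm_c_le
  have he : starAnsatz f A B c j (x, t) - (inAmplitude j * f (t + x) + outAmplitude j * f (t - x))
      = A j x * primitive f (t + x) + B j x * primitive f (t - x)
        + c * primitive (primitive f) (t - x) := by
    simp only [starAnsatz, waveAnsatz]; ring
  rw [he]
  refine norm_add₃_le.trans ?_
  simp only [norm_mul]
  calc _ ≤ (m * ∑ k, l k) * k + 2 * (m * ∑ k, l k) * k + 2 * m * (k * (2 * ∑ j, l j)) := by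
        refine add_le_add_three ?_ ?_ ?_
        · exact mul_le_mul hA hp (norm_nonneg _) ((norm_nonneg _).trans hA)
        · exact mul_le_mul hB hm (norm_nonneg _) ((norm_nonneg _).trans hB)
        · exact mul_le_mul hc hg (norm_nonneg _) ((norm_nonneg _).trans hc)
    _ = _ := by ring

lemma norm_ansatz_residual_le (H : IsStarAmplitudes l q m A B A' B' c) (hf : ContDiff ℝ 2 f)
    (j : Fin n) {x t k : ℝ} (hx : x ∈ Icc 0 (l j)) (hq : |q j x| ≤ m)
    (hp : ‖primitive f (t + x)‖ ≤ k) (hm : ‖primitive f (t - x)‖ ≤ k)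
    (hg : ‖primitive (primitive f) (t - x)‖ ≤ k * (2 * ∑ j, l j)) :
    ‖iteratedDeriv 2 (fun s => starAnsatz f A B c j (x, s)) t
        - iteratedDeriv 2 (fun y => starAnsatz f A B c j (y, t)) x
        + (q j x : ℂ) * starAnsatz f A B c j (x, t)‖
      ≤ (2 * m + 7 * m ^ 2 * ∑ j, l j) * k := by
  obtain ⟨A'', B'', hA'', hB'', hAb, hBb⟩ := H.exists_deriv₂ j x hx
  have hm0 : 0 ≤ m := (abs_nonneg _).trans hq
  have hA := H.norm_in_le j x hx
  have hB := H.norm_out_le j x hx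
  have hc := H.norm_c_le
  have hq' : ‖(q j x : ℂ)‖ ≤ m := by rwa [Complex.norm_real, Real.norm_eq_abs]
  simp only [starAnsatz]
  rw [waveAnsatz_residual hf (H.hasDerivAt_in j) (H.hasDerivAt_out j) hA'' hB''
    (H.transport_in j x hx) (H.transport_out j x hx)]
  refine norm_add₃_le.trans ?_
  have h₁ : ‖q j x * A j x - A''‖ ≤ m * (m * ∑ k, l k) + m := by
    refine (norm_sub_le _ _).trans (add_le_add ?_ hAb)
    rw [norm_mul]
    exact mul_le_mul hq' hA (norm_nonneg _) hm0
  have h₂ : ‖q j x * B j x - B''‖ ≤ m * (2 * (m * ∑ k, l k)) + m := by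
    refine (norm_sub_le _ _).trans (add_le_add ?_ hBb)
    rw [norm_mul]
    exact mul_le_mul hq' hB (norm_nonneg _) hm0
  have h₃ : ‖q j x * c‖ ≤ m * (2 * m) := by
    rw [norm_mul]
    exact mul_le_mul hq' hc (norm_nonneg _) hm0
  simp only [norm_mul _ (primitive _ _)]
  calc _ ≤ (m * (m * ∑ k, l k) + m) * k + (m * (2 * (m * ∑ k, l k)) + m) * k
        + m * (2 * m) * (k * (2 * ∑ j, l j)) := by
        refine add_le_add_three ?_ ?_ ?_
        · exact mul_le_mul h₁ hp (norm_nonneg _) ((norm_nonneg _).trans h₁)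
        · exact mul_le_mul h₂ hm (norm_nonneg _) ((norm_nonneg _).trans h₂)
        · exact mul_le_mul h₃ hg (norm_nonneg _) ((norm_nonneg _).trans h₃)
    _ = _ := by ring

end IsStarAmplitudes

end StarAnsatz

/-! ### The geometric optics approximation -/

section Approximation

variable {n : ℕ} [NeZero n] {l : Fin n → ℝ} {q : Fin n → ℝ → ℝ} {m : ℝ}
  {A B A' B' : Fin n → ℝ → ℂ} {c : ℂ} {f : ℝ → ℂ}

namespace IsStarAmplitudes

lemma contDiff_ansatz (H : IsStarAmplitudes l q m A B A' B' c) (hf : ContDiff ℝ 2 f) (j : Fin n) :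
    ContDiff ℝ 2 (starAnsatz f A B c j) :=
  contDiff_waveAnsatz hf (H.contDiff_in j) (H.contDiff_out j)

/-- A classical solution is close to the ansatz: their difference solves the wave equation with a
source proportional to the bound `k` for the primitive of `f`, and with homogeneous initial and
boundary data. -/
lemma norm_sub_ansatz_le (H : IsStarAmplitudes l q m A B A' B' c) (hl : ∀ j, 0 < l j)
    (hq : ∀ j, ∀ x ∈ Icc 0 (l j), |q j x| ≤ m) (hf : ContDiff ℝ 2 f) (hf0 : ∀ s ≤ 0, f s = 0)
    {T : ℝ} (hT0 : 0 ≤ T) (hTl : ∀ j, T ≤ l j) {v : Fin n → ℝ → ℝ → ℂ}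
    (hv : IsClassicalStarSolution l q (fun j t => if j = 0 then f (t + l 0) else 0) (-l 0) T v)
    {k : ℝ} (hF : ∀ s, |s| ≤ 2 * ∑ j, l j → ‖primitive f s‖ ≤ k)
    (j : Fin n) {x t : ℝ} (hx : x ∈ Icc 0 (l j)) (ht : t ∈ Icc (-l 0) T) :
    ‖v j x t - starAnsatz f A B c j (x, t)‖ ^ 2
      ≤ l j * (Real.exp ((2 + m) * (T - -l 0)) *
        (((2 * m + 7 * m ^ 2 * ∑ j, l j) * k) ^ 2 * ((∑ j, l j) * (T - -l 0)))) := by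
  have hT : -l 0 < T := by linarith [hl 0]
  have hlL i : l i ≤ ∑ j, l j :=
    Finset.single_le_sum (f := l) (fun k _ => (hl k).le) (Finset.mem_univ i)
  have ha i := H.contDiff_ansatz hf i
  have hcol i (x : ℝ) : ContDiff ℝ 2 fun s => starAnsatz f A B c i (x, s) :=
    (ha i).comp (contDiff_prodMk_right x)
  have hrow i (t : ℝ) : ContDiff ℝ 2 fun y => starAnsatz f A B c i (y, t) :=
    (ha i).comp (contDiff_prodMk_left t)
  have ht0 : -l 0 ∈ Icc (-l 0) T := left_mem_Icc.2 hT.le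
  refine norm_sq_le_of_star_wave_eq
    (w := fun i p => v i p.1 p.2 - starAnsatz f A B c i p) hl hT hq
    (fun i => (hv.contDiffOn i).sub (ha i).contDiffOn) ?_ ?_ ?_ ?_ ?_ ?_ j hx ht
  · intro i x hx t ht
    have hvi : ContDiffAt ℝ 2 (fun p : ℝ × ℝ => v i p.1 p.2) (x, t) :=
      (hv.contDiffOn i).contDiffAt (rectangle_mem_nhds hx ht)
    have hvt : ContDiffAt ℝ 2 (fun s => v i x s) t :=
      hvi.comp t (contDiff_prodMk_right x).contDiffAt
    have hvx : ContDiffAt ℝ 2 (fun y => v i y t) x :=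
      hvi.comp x (contDiff_prodMk_left t).contDiffAt
    have e₁ : iteratedDeriv 2 (fun s => v i x s - starAnsatz f A B c i (x, s)) t
        = iteratedDeriv 2 (fun s => v i x s) t
          - iteratedDeriv 2 (fun s => starAnsatz f A B c i (x, s)) t :=
      iteratedDeriv_sub hvt (hcol i x).contDiffAt
    have e₂ : iteratedDeriv 2 (fun y => v i y t - starAnsatz f A B c i (y, t)) x
        = iteratedDeriv 2 (fun y => v i y t) x
          - iteratedDeriv 2 (fun y => starAnsatz f A B c i (y, t)) x :=
      iteratedDeriv_sub hvx (hrow i t).contDiffAt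
    have hp : |t + x| ≤ 2 * ∑ j, l j := by
      rw [abs_le]
      constructor <;> linarith [hx.1, hx.2, ht.1, ht.2, hlL i, hlL 0, hTl i, hl 0]
    have hm : |t - x| ≤ 2 * ∑ j, l j := by
      rw [abs_le]
      constructor <;> linarith [hx.1, hx.2, ht.1, ht.2, hlL i, hlL 0, hTl i, hl 0]
    have hres := H.norm_ansatz_residual_le hf i (Ioo_subset_Icc_self hx)
      (hq i x (Ioo_subset_Icc_self hx)) (hF _ hp) (hF _ hm) (norm_primitive_le hF hm)
    refine le_trans (le_of_eq ?_) hres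
    rw [e₁, e₂, ← norm_neg, Complex.real_smul]
    congr 1
    linear_combination -hv.wave i x hx t ht
  · intro i x hx
    simp [hv.initial i x hx, H.ansatz_initial hf0 i hx (hl 0)]
  · intro i x hx
    have hvd : DifferentiableWithinAt ℝ (fun s => v i x s) (Icc (-l 0) T) (-l 0) :=
      (hasDerivWithinAt_partialSnd ((hv.contDiffOn i).differentiableOn two_ne_zero) hx
        ht0).differentiableWithinAt
    have := (hvd.hasDerivWithinAt.sub
      (H.ansatz_initial_deriv hf hf0 i hx (hl 0)).hasDerivWithinAt).derivWithin
      (uniqueDiffOn_Icc hT _ ht0)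
    rw [hv.initial_deriv i x hx, sub_zero] at this
    exact this
  · intro i t ht
    simp only [hv.dirichlet i t ht, H.ansatz_leaf hf0 i (ht.2.trans (hTl i)), inAmplitude]
    by_cases hi : i = 0
    · subst hi; simp
    · simp [hi]
  · intro i i' t ht
    simp only [hv.continuity i i' t ht, H.ansatz_continuity i i' t]
  · intro t ht
    rw [← sub_zero (0 : ℂ)]
    nth_rewrite 1 [← hv.kirchhoff t ht]
    rw [← H.ansatz_kirchhoff hl hf t, ← Finset.sum_sub_distrib]
    refine Finset.sum_congr rfl fun i _ => ?_
    have h0 : (0 : ℝ) ∈ Icc 0 (l i) := left_mem_Icc.2 (hl i).le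
    have hvd : DifferentiableWithinAt ℝ (fun y => v i y t) (Icc 0 (l i)) 0 :=
      (hasDerivWithinAt_partialFst ((hv.contDiffOn i).differentiableOn two_ne_zero) h0
        ht).differentiableWithinAt
    exact derivWithin_fun_sub hvd
      ((hrow i t).differentiable two_ne_zero 0).differentiableWithinAt

end IsStarAmplitudes

/-- A classical solution differs from the leading-order waves by `O(h)`, uniformly on all edges. -/
theorem exists_norm_sub_leading_le (hl : ∀ j, 0 < l j) {b : ℝ} {χ : ℝ → ℝ} (hχ : IsCutoff b χ)
    (M : ℝ) :
    ∃ C : ℝ, 0 < C ∧ ∀ q : Fin n → ℝ → ℝ, IsC1PotentialWithBound l M q → ∀ h : ℝ, 0 < h →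
      ∀ v : Fin n → ℝ → ℝ → ℂ,
        IsClassicalStarSolution l q (starSource l h χ) (-l 0) (⨅ j, l j) v →
        ∀ t ∈ Icc 0 (⨅ j, l j), ∀ j, ∀ x ∈ Icc 0 (l j),
          ‖v j x t - (inAmplitude j * goProfile h χ (t + x)
            + outAmplitude j * goProfile h χ (t - x))‖ ≤ C * h := by
  set T := ⨅ j, l j
  set L := ∑ j, l j
  have hTl j : T ≤ l j := ciInf_le (Set.finite_range l).bddBelow j
  have hT0 : 0 ≤ T := le_ciInf fun j => (hl j).le
  have hlL i : l i ≤ L :=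
    Finset.single_le_sum (f := l) (fun k _ => (hl k).le) (Finset.mem_univ i)
  have hL0 : 0 ≤ L := (hl 0).le.trans (hlL 0)
  obtain ⟨K, hK0, hK⟩ := exists_norm_primitive_goProfile_le hχ (2 * L)
  -- the constant in the energy estimate, for a source of size one
  set D := Real.sqrt (L * (Real.exp ((2 + |M|) * (T - -l 0)) * (L * (T - -l 0)))) with hD
  refine ⟨7 * |M| * L * K + D * ((2 * |M| + 7 * |M| ^ 2 * L) * K) + 1, by positivity, ?_⟩
  intro q hq h hh v hv t ht j x hx
  have hM : |M| = M := abs_of_nonneg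
    ((abs_nonneg _).trans (hq.abs_le 0 0 (left_mem_Icc.2 (hl 0).le)))
  rw [hM] at hD ⊢
  have hM0 : 0 ≤ M := hM ▸ abs_nonneg M
  obtain ⟨A, B, A', B', c, H⟩ := exists_isStarAmplitudes hl hq
  have hf : ContDiff ℝ 2 (goProfile h χ) := contDiff_goProfile (m := 2) hχ
  have hF s (hs : |s| ≤ 2 * L) := hK h hh s hs
  have hmem : t ∈ Icc (-l 0) T := ⟨by linarith [hl 0, ht.1], ht.2⟩
  have hw := H.norm_sub_ansatz_le hl hq.abs_le hf (fun s hs => goProfile_eq_zero hχ hs) hT0 hTl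
    hv hF j hx hmem
  have hp : |t + x| ≤ 2 * L := by
    rw [abs_le]; constructor <;> linarith [hx.1, hx.2, ht.1, ht.2, hlL j, hTl j]
  have hm : |t - x| ≤ 2 * L := by
    rw [abs_le]; constructor <;> linarith [hx.1, hx.2, ht.1, ht.2, hlL j, hTl j]
  have hlead := H.norm_ansatz_sub_le j hx (hF _ hp) (hF _ hm) (norm_primitive_le hF hm)
  set κ := (2 * M + 7 * M ^ 2 * L) * (K * h) with hκ
  have hκ0 : 0 ≤ κ := by positivity
  have hTpos : 0 ≤ T - -l 0 := by linarith [hl 0]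
  have hsol : ‖v j x t - starAnsatz (goProfile h χ) A B c j (x, t)‖ ≤ D * κ := by
    refine (sq_le_sq₀ (norm_nonneg _) (by positivity)).1 (hw.trans ?_)
    rw [mul_pow D κ, hD, Real.sq_sqrt (by positivity)]
    calc _ ≤ L * (Real.exp ((2 + M) * (T - -l 0)) * (κ ^ 2 * (L * (T - -l 0)))) := by
          gcongr
          exact hlL j
      _ = _ := by ring
  calc _ ≤ D * κ + 7 * M * L * (K * h) := (norm_sub_le_norm_sub_add_norm_sub _ _ _).trans
        (add_le_add hsol hlead)
    _ ≤ _ := by rw [hκ]; nlinarith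

end Approximation

theorem lemma3p2 (n : ℕ) [NeZero n] (l : Fin n → ℝ) (hl : ∀ j, 0 < l j)
    (b : ℝ) (hb : 0 < b) (χ : ℝ → ℝ) (hχ : IsCutoff b χ) (M : ℝ) :
    ∃ C : ℝ, 0 < C ∧
      ∀ q : Fin n → ℝ → ℝ, IsC1PotentialWithBound l M q →
      ∀ h : ℝ, 0 < h →
      ∀ v : Fin n → ℝ → ℝ → ℂ,
        IsClassicalStarSolution l q (starSource l h χ) (-l 0) (⨅ j, l j) v →
        ∀ t ∈ Set.Icc 0 (⨅ j, l j),
          (∀ x ∈ Set.Icc 0 (l 0),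
            ‖v 0 x t - (goProfile h χ (t + x)
                - (((n : ℂ) - 2) / (n : ℂ)) * goProfile h χ (t - x))‖ ≤ C * h) ∧
          (∀ j : Fin n, j ≠ 0 → ∀ x ∈ Set.Icc 0 (l j),
            ‖v j x t - (2 / (n : ℂ)) * goProfile h χ (t - x)‖ ≤ C * h) := by
  have hn : (n : ℂ) ≠ 0 := NeZero.ne _
  obtain ⟨C, hC, hmain⟩ := exists_norm_sub_leading_le hl hχ M
  refine ⟨C, hC, fun q hq h hh v hv t ht => ⟨fun x hx => ?_, fun j hj x hx => ?_⟩⟩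
  · convert hmain q hq h hh v hv t ht 0 x hx using 3
    simp only [outAmplitude, inAmplitude, if_true]
    push_cast
    field_simp
    ring
  · convert hmain q hq h hh v hv t ht j x hx using 3
    simp [outAmplitude, inAmplitude_of_ne_zero hj]
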